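/- There are absolute constants $c, C > 0$ with the following property. Let $m,n$ be positive integers, let $M \in \mathbb{R}^{m\times n}$ be an arbitrary fixed matrix, and let $R=(r_{ij}) \in \mathbb{R}^{m\times n}$ be a random matrix with independent entries that have finite fourth moments and all the same variance ($R$ is $2$-central). For $k\ge 2$ put $\mu_k(R) := \max_{i,j} \left|\mathbb{E}\{(r_{ij}-\mathbb{E}r_{ij})^k\}\right|$ and $$K(R) := \mu_2(R)^2+\mu_3(R)+\mu_2(R)\mu_3(R)+\mu_4(R),$$ and suppose that $\mu_2(R)>0$. Let $\kappa>0$ and $\alpha\ge 1/2$, and assume that $R-\mathbb{E}\{R\}$ is $(\kappa,\alpha,\log(en))$-reasonable, i.e. $\left(\mathbb{E}|r_{ij}-\mathbb{E}r_{ij}|^p\right)^{1/p} \le \kappa p^{\alpha}$ for all $i,j$ and all real $1\le p\le \log(en)$. Let $\rho\in(0,1)$, $\tau>0$ and $s\in\{1,\dots,n\}$. Set $$F(M+R) := \min\left\{\|M+\mathbb{E}\{R\}\|_{\mathsf{F},s},\ \sqrt{s\log n}\,\|M+\mathbb{E}\{R\}\|_\infty\right\},$$ where, for $B=(b_{ij})\in\mathbb{R}^{m\times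 n}$, $\|B\|_{\mathsf{F},s} := \max_{S\subseteq[n],\,|S|=s}\sqrt{\sum_{j\in S}\sum_{i=1}^m b_{ij}^2}$ and $\|B\|_\infty:=\max_{i,j}|b_{ij}|$. If $m\ge\max\{\ell_1,\ell_2\}$, where $$\ell_1 := C\left(\frac{K(R)}{\mu_2(R)^{5/2}\tau}\left(1+\tau\rho^{-1}\Big(e^{2\alpha}\kappa\sqrt{s\log(en/s)}+F(M+R)\Big)\right)\right)^2,\qquad \ell_2:=(\log(en))^{\max\{2\alpha-1,1\}},$$ then, with probability at least $$1-\exp\left(-c\,\frac{\mu_2(R)^4}{K(R)^2}\,m\right),$$ the matrix $M+R$ satisfies $\ell_2$-$\mathrm{RNSP}(s,\rho,\tau)$, that is, $$\|v_S\|_2\le\frac{\rho}{\sqrt{s}}\,\|v_{\bar S}\|_1+\tau\,\|(M+R)v\|_2$$ holds for every $v\in\mathbb{R}^n$ and every $S\subseteq[n]$ with $|S|\le s$, where $\bar S=[n]\setminus S$ and $v_S$ agrees with $v$ on $S$ and vanishes outside $S$. -/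

import Mathlib

open MeasureTheory ProbabilityTheory

noncomputable section

namespace RNSP

/-- The robust null space property `ℓ₂-RNSP(s, ρ, τ)`: for every `S ⊆ [n]` with `|S| ≤ s` and every
`v ∈ ℝⁿ`, `‖v_S‖₂ ≤ (ρ / √s) ‖v_{Sᶜ}‖₁ + τ ‖A v‖₂`. -/
def L2RNSP {m n : ℕ} (A : Matrix (Fin m) (Fin n) ℝ) (s : ℕ) (ρ τ : ℝ) : Prop :=
  ∀ S : Finset (Fin n), S.card ≤ s → ∀ v : Fin n → ℝ,
    √(∑ j ∈ S, v j ^ 2) ≤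
      ρ / √(s : ℝ) * ∑ j ∈ Sᶜ, |v j| + τ * √(∑ i, (A.mulVec v i) ^ 2)

/-- The localised Frobenius norm `‖A‖_{F,s}`: the largest Frobenius norm of an `m × s` submatrix. -/
def locFrob {m n : ℕ} (A : Matrix (Fin m) (Fin n) ℝ) (s : ℕ) : ℝ :=
  ⨆ S : {S : Finset (Fin n) // S.card = s}, √(∑ j ∈ S.1, ∑ i, A i j ^ 2)

/-- The largest absolute value of an entry, `‖A‖_∞`. -/
def supNorm {m n : ℕ} (A : Matrix (Fin m) (Fin n) ℝ) : ℝ :=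
  ⨆ ij : Fin m × Fin n, |A ij.1 ij.2|

variable {Ω : Type*} [MeasurableSpace Ω] {m n : ℕ}

/-- The entrywise expectation of a random matrix. -/
def expMatrix (A : Ω → Matrix (Fin m) (Fin n) ℝ) (P : Measure Ω) : Matrix (Fin m) (Fin n) ℝ :=
  Matrix.of fun i j => ∫ ω, A ω i j ∂P

/-- A random matrix is `k`-central if, for each `1 ≤ p ≤ k`, all its entries have the same `p`-th
central moment. -/
def IsCentral (k : ℕ) (A : Ω → Matrix (Fin m) (Fin n) ℝ) (P : Measure Ω) : Prop :=
  ∀ p : ℕ, 1 ≤ p → p ≤ k → ∀ (i i' : Fin m) (j j' : Fin n),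
    centralMoment (fun ω => A ω i j) p P = centralMoment (fun ω => A ω i' j') p P

/-- `μ_k(A)`, the largest absolute value of the `k`-th central moment of an entry. -/
def muMat (k : ℕ) (A : Ω → Matrix (Fin m) (Fin n) ℝ) (P : Measure Ω) : ℝ :=
  ⨆ ij : Fin m × Fin n, |centralMoment (fun ω => A ω ij.1 ij.2) k P|

/-- `K(A) = μ₂(A)² + μ₃(A) + μ₂(A) μ₃(A) + μ₄(A)`. -/
def KMat (A : Ω → Matrix (Fin m) (Fin n) ℝ) (P : Measure Ω) : ℝ :=
  muMat 2 A P ^ 2 + muMat 3 A P + muMat 2 A P * muMat 3 A P + muMat 4 A P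

/-- A random variable is `(κ, α, r)`-reasonable if `‖X‖_p ≤ κ p ^ α` for all real `1 ≤ p ≤ r`. -/
def Reasonable (κ α r : ℝ) (X : Ω → ℝ) (P : Measure Ω) : Prop :=
  ∀ p : ℝ, 1 ≤ p → p ≤ r → eLpNorm X (ENNReal.ofReal p) P ≤ ENNReal.ofReal (κ * p ^ α)

/-- A random matrix is `(κ, α, r)`-reasonable if each entry is. -/
def ReasonableMat (κ α r : ℝ) (A : Ω → Matrix (Fin m) (Fin n) ℝ) (P : Measure Ω) : Prop :=
  ∀ i j, Reasonable κ α r (fun ω => A ω i j) P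

/-- `F(A) = min {‖𝔼 A‖_{F,s}, √(s log n) ‖𝔼 A‖_∞}`. -/
def FMat (s : ℕ) (A : Ω → Matrix (Fin m) (Fin n) ℝ) (P : Measure Ω) : ℝ :=
  min (locFrob (expMatrix A P) s) (√(s * Real.log n) * supNorm (expMatrix A P))

end RNSP

end

noncomputable section

namespace RNSP

/-! ### Integrals over finite products of probability spaces -/

section Pi

variable {E : Type*} [MeasurableSpace E]

/-! A violation of the null space property, after normalisation, is a unit vector `v` with `‖v‖₁ ≤
(1 + ρ⁻¹)√s` and `‖(M + R)v‖₂ < 1/τ` (`l2RNSP_of_unitCone`). So it suffices to bound `∑ᵢ ⟨rowᵢ, v⟩²`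
below by `1/τ²`, uniformly over this cone.

With only four moments the squares may be heavy-tailed, but large values only help, so each square
is truncated at `H = 16 μ₄/σ₂`, where `σ₂` is the common variance. Whatever the deterministic shift,
the truncated square keeps mean at least `σ₂/2` (`half_variance_le_integral_min_sq`). The largest
deficit of the empirical sums below their means is a function of independent rows with differences
at most `H`, so McDiarmid's inequality controls its fluctuations; this gives the exponent `m
σ₂⁴/(8192 μ₄²)`.

It remains to bound the expected deficit. The truncated square is `2√H`-Lipschitz in the linear
form, so symmetrization and contraction (`integral_iSup_sum_le_of_contraction`) leave a Rademacher
average of linear forms. On the cone this is at most `(2 + ρ⁻¹)` times the norm of the `s` largest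
coordinates of `∑ εᵢ rowᵢ` (`sum_mul_le_topNorm`), which splits into the mean matrix and the centred
noise.

For the mean matrix, Cauchy–Schwarz gives the localised Frobenius norm, and moments of order about
`log n` give `√(s log n)‖·‖_∞`. For the noise, moments of order about `log(en/s)` are used: the
normalised even moments `𝔼 z^{2j}/(2j)!` of independent symmetric summands convolve like
coefficients of a generating function cut off at degree `k`, so no exponential moments are needed,
and `m ≥ ℓ₂` makes `(𝔼 (∑ zᵢ)^{2k})^{1/(2k)}` grow only like `√(mk)`. For `n ≤ 2` the growth
condition does not reach the second moment and the variance is used instead.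

Only `μ₂` and `μ₄ ≤ K(R)` matter for the argument. -/

lemma measurePreserving_cons {m : ℕ} (ν : Fin (m + 1) → Measure E)
    [∀ i, IsProbabilityMeasure (ν i)] :
    MeasurePreserving (fun p : E × (Fin m → E) => (Fin.cons p.1 p.2 : Fin (m + 1) → E))
      ((ν 0).prod (Measure.pi fun i => ν i.succ)) (Measure.pi ν) := by
  have h := (measurePreserving_piFinSuccAbove ν 0).symm
  simpa [MeasurableEquiv.piFinSuccAbove, Fin.insertNthEquiv, Fin.zero_succAbove,
    Fin.insertNth_zero'] using h

lemma measurable_cons {m : ℕ} :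
    Measurable (fun p : E × (Fin m → E) => (Fin.cons p.1 p.2 : Fin (m + 1) → E)) := by
  refine measurable_pi_iff.2 fun i => ?_
  refine Fin.cases ?_ (fun j => ?_) i
  · simpa using measurable_fst
  · simpa [Function.comp_def] using
      (measurable_pi_apply j).comp (measurable_snd (α := E) (β := Fin m → E))

lemma integrable_cons {m : ℕ} (ν : Fin (m + 1) → Measure E)
    [∀ i, IsProbabilityMeasure (ν i)] {f : (Fin (m + 1) → E) → ℝ}
    (hf : Integrable f (Measure.pi ν)) :
    Integrable (fun p : E × (Fin m → E) => f (Fin.cons p.1 p.2))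
      ((ν 0).prod (Measure.pi fun i => ν i.succ)) :=
  (measurePreserving_cons ν).integrable_comp_of_integrable hf

lemma integral_pi_succ {m : ℕ} (ν : Fin (m + 1) → Measure E)
    [∀ i, IsProbabilityMeasure (ν i)] {f : (Fin (m + 1) → E) → ℝ}
    (hf : Integrable f (Measure.pi ν)) :
    ∫ x, f x ∂(Measure.pi ν) =
      ∫ a, ∫ y, f (Fin.cons a y) ∂(Measure.pi fun i => ν i.succ) ∂(ν 0) := by
  have h := measurePreserving_cons ν
  rw [← integral_prod (fun p : E × (Fin m → E) => f (Fin.cons p.1 p.2)) (integrable_cons ν hf),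
    ← h.map_eq, integral_map h.measurable.aemeasurable]
  rw [h.map_eq]
  exact hf.aestronglyMeasurable

lemma integrable_of_abs_le {Ω : Type*} [MeasurableSpace Ω] {μ : Measure Ω} [IsFiniteMeasure μ]
    {f : Ω → ℝ} (hf : Measurable f) (b : ℝ) (hb : ∀ x, |f x| ≤ b) : Integrable f μ :=
  Integrable.of_bound hf.aestronglyMeasurable b (Filter.Eventually.of_forall hb)

/-- Hoeffding's lemma for a bounded function of oscillation at most `c`. -/
lemma integral_exp_le_of_osc {μ : Measure E} [IsProbabilityMeasure μ] {f : E → ℝ}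
    (hf : Measurable f) {b c : ℝ} (hb : ∀ x, |f x| ≤ b) (hc : ∀ x y, f x - f y ≤ c) (t : ℝ) :
    ∫ x, Real.exp (t * f x) ∂μ ≤ Real.exp (t * ∫ x, f x ∂μ + c ^ 2 * t ^ 2 / 8) := by
  have : Nonempty E := nonempty_of_isProbabilityMeasure μ
  have hbdd : BddBelow (Set.range f) :=
    ⟨-b, by rintro _ ⟨x, rfl⟩; exact (abs_le.1 (hb x)).1⟩
  -- The interval is anchored at the infimum of `f`, so its length is the oscillation `c` and not
  -- the cruder `2 * b`.
  have hmem : ∀ x, f x ∈ Set.Icc (⨅ y, f y) ((⨅ y, f y) + c) := fun x =>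
    ⟨ciInf_le hbdd x, by
      have : f x - c ≤ ⨅ y, f y := le_ciInf fun y => by linarith [hc x y]
      linarith⟩
  have hsub := (hasSubgaussianMGF_of_mem_Icc (μ := μ) hf.aemeasurable
    (Filter.Eventually.of_forall hmem)).mgf_le t
  have hsplit : ∀ x, Real.exp (t * f x) =
      Real.exp (t * ∫ x, f x ∂μ) * Real.exp (t * (f x - ∫ x, f x ∂μ)) := fun x => by
    rw [← Real.exp_add]; ring_nf
  simp_rw [hsplit]
  rw [integral_const_mul, Real.exp_add]
  refine mul_le_mul_of_nonneg_left (hsub.trans_eq ?_) (Real.exp_pos _).le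
  congr 1
  simp only [NNReal.coe_pow, NNReal.coe_div, coe_nnnorm, Real.norm_eq_abs, NNReal.coe_ofNat,
    add_sub_cancel_left, div_pow, sq_abs]
  ring

/-- The exponential moment bound behind McDiarmid's inequality. -/
lemma integral_exp_le_of_bounded_differences {m : ℕ} (ν : Fin m → Measure E)
    [∀ i, IsProbabilityMeasure (ν i)] {f : (Fin m → E) → ℝ} (hf : Measurable f) {b c : ℝ}
    (hb : ∀ x, |f x| ≤ b)
    (hc : ∀ (x : Fin m → E) (i : Fin m) (a : E), f x - f (Function.update x i a) ≤ c) (t : ℝ) :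
    ∫ x, Real.exp (t * f x) ∂(Measure.pi ν) ≤
      Real.exp (t * ∫ x, f x ∂(Measure.pi ν) + m * (c ^ 2 * t ^ 2 / 8)) := by
  induction m with
  | zero =>
    have h : ∀ x : Fin 0 → E, f x = f default := fun x => by rw [Subsingleton.elim x default]
    simp_rw [h]
    simp
  | succ m ih =>
    set ν' : Fin m → Measure E := fun i => ν i.succ
    -- Conditioning on the first coordinate: `fb` inherits oscillation at most `c`, so Hoeffding's
    -- lemma handles it, and the remaining coordinates are left to induction.
    set fb : E → ℝ := fun a => ∫ y, f (Fin.cons a y) ∂(Measure.pi ν')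
    have hexp_le : ∀ x, |Real.exp (t * f x)| ≤ Real.exp (|t| * b) := fun x => by
      rw [abs_of_pos (Real.exp_pos _), Real.exp_le_exp]
      exact (le_abs_self _).trans
        (by rw [abs_mul]; exact mul_le_mul_of_nonneg_left (hb x) (abs_nonneg t))
    have hexpm : Measurable fun x => Real.exp (t * f x) := (hf.const_mul t).exp
    have hfc : ∀ a, Measurable fun y : Fin m → E => f (Fin.cons a y) := fun a =>
      hf.comp (measurable_cons.comp measurable_prodMk_left)
    have hfci : ∀ a, Integrable (fun y : Fin m → E => f (Fin.cons a y)) (Measure.pi ν') :=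
      fun a => integrable_of_abs_le (hfc a) b fun y => hb _
    have hfbm : Measurable fb := by
      have : StronglyMeasurable (Function.uncurry fun (a : E) (y : Fin m → E) =>
          f (Fin.cons a y)) := (hf.comp measurable_cons).stronglyMeasurable
      exact this.integral_prod_right.measurable
    have hfbb : ∀ a, |fb a| ≤ b := fun a => by
      have := norm_integral_le_of_norm_le_const (μ := Measure.pi ν')
        (f := fun y : Fin m → E => f (Fin.cons a y)) (C := b)
        (Filter.Eventually.of_forall fun y => hb _)
      simpa using this
    have hfbc : ∀ a a', fb a - fb a' ≤ c := fun a a' => by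
      rw [← integral_sub (hfci a) (hfci a')]
      calc _ ≤ ∫ _ : Fin m → E, c ∂(Measure.pi ν') := by
            refine integral_mono ((hfci a).sub (hfci a')) (integrable_const _) fun y => ?_
            have := hc (Fin.cons a y) 0 a'
            rwa [Fin.update_cons_zero] at this
        _ = c := by simp
    have hfint : Integrable f (Measure.pi ν) := integrable_of_abs_le hf b hb
    have heint : Integrable (fun x => Real.exp (t * f x)) (Measure.pi ν) :=
      integrable_of_abs_le hexpm _ hexp_le
    rw [integral_pi_succ ν hfint, integral_pi_succ ν heint]
    calc _ ≤ ∫ a, Real.exp (t * fb a) * Real.exp (m * (c ^ 2 * t ^ 2 / 8)) ∂(ν 0) := by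
          refine integral_mono (integrable_cons ν heint).integral_prod_left
            ((integrable_of_abs_le (hfbm.const_mul t).exp (Real.exp (|t| * b))
              fun a => ?_).mul_const _) fun a => ?_
          · rw [abs_of_pos (Real.exp_pos _), Real.exp_le_exp]
            exact (le_abs_self _).trans
              (by rw [abs_mul]; exact mul_le_mul_of_nonneg_left (hfbb a) (abs_nonneg t))
          · simp only
            rw [← Real.exp_add]
            refine ih ν' (hfc a) (fun y => hb _) fun x i a' => ?_
            have := hc (Fin.cons a x) i.succ a'
            rwa [← Fin.cons_update] at this
      _ ≤ Real.exp (t * ∫ a, fb a ∂(ν 0) + c ^ 2 * t ^ 2 / 8) *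
          Real.exp (m * (c ^ 2 * t ^ 2 / 8)) := by
          rw [integral_mul_const]
          exact mul_le_mul_of_nonneg_right (integral_exp_le_of_osc hfbm hfbb hfbc t)
            (Real.exp_pos _).le
      _ = _ := by
          rw [← Real.exp_add]; push_cast; ring_nf; rfl

/-- McDiarmid's bounded differences inequality. -/
lemma measureReal_ge_le_of_bounded_differences {m : ℕ} (ν : Fin m → Measure E)
    [∀ i, IsProbabilityMeasure (ν i)] {f : (Fin m → E) → ℝ} (hf : Measurable f) {b c : ℝ}
    (hb : ∀ x, |f x| ≤ b)
    (hc : ∀ (x : Fin m → E) (i : Fin m) (a : E), f x - f (Function.update x i a) ≤ c)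
    (hm : 0 < m) (hc0 : 0 < c) {r : ℝ} (hr : 0 ≤ r) :
    (Measure.pi ν).real {x | ∫ y, f y ∂(Measure.pi ν) + r ≤ f x} ≤
      Real.exp (-(2 * r ^ 2 / (m * c ^ 2))) := by
  have hm' : (0 : ℝ) < m := by exact_mod_cast hm
  -- The minimiser of `-t * r + m * c ^ 2 * t ^ 2 / 8`.
  set t : ℝ := 4 * r / (m * c ^ 2)
  have ht : 0 ≤ t := by positivity
  have hinteg : Integrable (fun x => Real.exp (t * f x)) (Measure.pi ν) := by
    refine integrable_of_abs_le (hf.const_mul t).exp (Real.exp (|t| * b)) fun x => ?_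
    rw [abs_of_pos (Real.exp_pos _), Real.exp_le_exp]
    exact (le_abs_self _).trans
      (by rw [abs_mul]; exact mul_le_mul_of_nonneg_left (hb x) (abs_nonneg t))
  refine (measure_ge_le_exp_mul_mgf (∫ y, f y ∂(Measure.pi ν) + r) ht hinteg).trans ?_
  refine (mul_le_mul_of_nonneg_left
    (integral_exp_le_of_bounded_differences ν hf hb hc t) (Real.exp_pos _).le).trans_eq ?_
  rw [← Real.exp_add]
  congr 1
  simp only [t]
  field_simp
  ring

end Pi

/-! ### Symmetrization and contraction -/

section Symmetrization

lemma le_iSup_of_finite {ι : Type*} [Finite ι] (f : ι → ℝ) (i : ι) : f i ≤ ⨆ j, f j :=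
  le_ciSup (Set.finite_range f).bddAbove i

variable {ι : Type*} [Finite ι] [Nonempty ι]

lemma iSup_le_iSup_add {f g : ι → ℝ} {c : ℝ} (h : ∀ i, f i ≤ g i + c) :
    ⨆ i, f i ≤ (⨆ i, g i) + c :=
  ciSup_le fun i => (h i).trans (by linarith [le_iSup_of_finite g i])

lemma abs_iSup_le {f : ι → ℝ} {b : ℝ} (h : ∀ i, |f i| ≤ b) : |⨆ i, f i| ≤ b := by
  obtain ⟨i, hi⟩ := exists_eq_ciSup_of_finite (f := f)
  rw [← hi]; exact h i

lemma integrable_iSup {Ω : Type*} [MeasurableSpace Ω] {μ : Measure Ω} {f : ι → Ω → ℝ}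
    (hf : ∀ i, Integrable (f i) μ) : Integrable (fun ω => ⨆ i, f i ω) μ := by
  have := Fintype.ofFinite ι
  refine Integrable.mono' (g := fun ω => ∑ i, |f i ω|)
    (integrable_finsetSum _ fun i _ => (hf i).abs) ?_ (Filter.Eventually.of_forall fun ω => ?_)
  · exact (AEMeasurable.iSup fun i => (hf i).aemeasurable).aestronglyMeasurable
  · refine abs_iSup_le fun i => ?_
    exact Finset.single_le_sum (f := fun i => |f i ω|) (fun j _ => abs_nonneg _)
      (Finset.mem_univ i)

/-- Talagrand's contraction principle for a single Rademacher sign. -/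
lemma iSup_add_iSup_le_of_contraction {g p q : ι → ℝ}
    (h : ∀ v w, |p v - p w| ≤ |q v - q w|) :
    (⨆ v, (g v + p v)) + (⨆ v, (g v - p v)) ≤ (⨆ v, (g v + q v)) + ⨆ v, (g v - q v) := by
  obtain ⟨v, hv⟩ := exists_eq_ciSup_of_finite (f := fun v => g v + p v)
  obtain ⟨w, hw⟩ := exists_eq_ciSup_of_finite (f := fun v => g v - p v)
  rw [← hv, ← hw]
  have h1 := le_iSup_of_finite (fun v => g v + q v) v
  have h2 := le_iSup_of_finite (fun v => g v - q v) w
  have h3 := le_iSup_of_finite (fun v => g v + q v) w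
  have h4 := le_iSup_of_finite (fun v => g v - q v) v
  have h5 := (le_abs_self _).trans (h v w)
  rcases abs_cases (q v - q w) with ⟨h6, _⟩ | ⟨h6, _⟩ <;> linarith

/-- The uniform measure on `Bool`. -/
def coin : Measure Bool :=
  (2⁻¹ : ENNReal) • Measure.dirac true + (2⁻¹ : ENNReal) • Measure.dirac false

instance : IsProbabilityMeasure coin :=
  ⟨by simp [coin, ENNReal.inv_two_add_inv_two]⟩

/-- The sign `±1` attached to a Boolean. -/
def sgn (b : Bool) : ℝ := if b then 1 else -1

lemma sgn_sq (b : Bool) : sgn b ^ 2 = 1 := by cases b <;> simp [sgn]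

lemma integral_coin (f : Bool → ℝ) : ∫ b, f b ∂coin = (f true + f false) / 2 := by
  rw [coin, integral_add_measure ((integrable_dirac (by simp)).smul_measure (by simp))
    ((integrable_dirac (by simp)).smul_measure (by simp))]
  simp only [integral_smul_measure, integral_dirac]
  simp
  ring

lemma integrable_coin (f : Bool → ℝ) : Integrable f coin := Integrable.of_finite

variable {E : Type*} [MeasurableSpace E]

/-- One step of symmetrization followed by contraction. -/
lemma integral_iSup_le_of_contraction {μ : Measure E} [IsProbabilityMeasure μ] {ψ q : E → ι → ℝ}
    (g : ι → ℝ) (hψ : ∀ v, Integrable (fun x => ψ x v) μ)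
    (hq : ∀ v, Integrable (fun x => q x v) μ)
    (h : ∀ x v w, 2 * |ψ x v - ψ x w| ≤ |q x v - q x w|) :
    ∫ x, ⨆ v, (g v + (∫ y, ψ y v ∂μ - ψ x v)) ∂μ ≤
      ∫ z, ⨆ v, (g v + sgn z.2 * q z.1 v) ∂(μ.prod coin) := by
  have hi1 : Integrable (fun x => ⨆ v, (g v + 2 * ψ x v)) μ :=
    integrable_iSup fun v => (integrable_const _).add ((hψ v).const_mul 2)
  have hi2 : Integrable (fun x => ⨆ v, (g v - 2 * ψ x v)) μ :=
    integrable_iSup fun v => (integrable_const _).sub ((hψ v).const_mul 2)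
  have hi3 : Integrable (fun x => ⨆ v, (g v + q x v)) μ :=
    integrable_iSup fun v => (integrable_const _).add (hq v)
  have hi4 : Integrable (fun x => ⨆ v, (g v - q x v)) μ :=
    integrable_iSup fun v => (integrable_const _).sub (hq v)
  -- No ghost sample is needed: `g + (𝔼ψ - ψ)` is the average of `g + 2 𝔼ψ` and `g - 2ψ`, and a
  -- supremum of means is at most the mean of the suprema. The two signs of `2ψ` then form the
  -- Rademacher average to be contracted.
  have hmean : ⨆ v, (g v + 2 * ∫ y, ψ y v ∂μ) ≤ ∫ x, ⨆ v, (g v + 2 * ψ x v) ∂μ := by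
    refine ciSup_le fun v => ?_
    have : g v + 2 * ∫ y, ψ y v ∂μ = ∫ x, (g v + 2 * ψ x v) ∂μ := by
      rw [integral_add (integrable_const _) ((hψ v).const_mul 2), integral_const_mul]; simp
    rw [this]
    exact integral_mono ((integrable_const _).add ((hψ v).const_mul 2)) hi1
      fun x => le_iSup_of_finite (fun v => g v + 2 * ψ x v) v
  have hprod : Integrable (fun z : E × Bool => ⨆ v, (g v + sgn z.2 * q z.1 v)) (μ.prod coin) :=
    integrable_iSup fun v => (integrable_const _).add <| by
      simpa only [mul_comm] using (hq v).mul_prod (integrable_coin sgn)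
  rw [integral_prod _ hprod]
  simp_rw [integral_coin]
  calc ∫ x, ⨆ v, (g v + (∫ y, ψ y v ∂μ - ψ x v)) ∂μ
      ≤ ∫ x, ((⨆ v, (g v + 2 * ∫ y, ψ y v ∂μ)) / 2 + (⨆ v, (g v - 2 * ψ x v)) / 2) ∂μ := by
        refine integral_mono (integrable_iSup fun v => (integrable_const _).add
          ((integrable_const _).sub (hψ v))) ((integrable_const _).add (hi2.div_const 2))
          fun x => ciSup_le fun v => ?_
        have h1 := le_iSup_of_finite (fun v => g v + 2 * ∫ y, ψ y v ∂μ) v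
        have h2 := le_iSup_of_finite (fun v => g v - 2 * ψ x v) v
        simp only at h1 h2 ⊢
        linarith
    _ ≤ ∫ x, ((⨆ v, (g v + 2 * ψ x v)) + (⨆ v, (g v - 2 * ψ x v))) / 2 ∂μ := by
        rw [integral_add (integrable_const _) (hi2.div_const 2), integral_div, integral_div,
          integral_div, integral_add hi1 hi2]
        simp only [integral_const, probReal_univ, smul_eq_mul, one_mul]
        linarith
    _ ≤ ∫ x, ((⨆ v, (g v + q x v)) + (⨆ v, (g v - q x v))) / 2 ∂μ := by
        refine integral_mono ((hi1.add hi2).div_const 2) ((hi3.add hi4).div_const 2) fun x => ?_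
        have := iSup_add_iSup_le_of_contraction (g := g) (p := fun v => 2 * ψ x v) (q := q x)
          fun v w => by
            rw [← mul_sub, abs_mul]; simpa using h x v w
        simp only
        linarith
    _ = _ := by simp [sgn, sub_eq_add_neg]

/-- Expected suprema of centred empirical sums are dominated by Rademacher averages of a
process whose increments dominate those of the summands. -/
lemma integral_iSup_sum_le_of_contraction {m : ℕ} (ν : Fin m → Measure E)
    [∀ i, IsProbabilityMeasure (ν i)] {ψ q : Fin m → E → ι → ℝ} (g : ι → ℝ)
    (hψ : ∀ i v, Integrable (fun x => ψ i x v) (ν i))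
    (hq : ∀ i v, Integrable (fun x => q i x v) (ν i))
    (h : ∀ i x v w, 2 * |ψ i x v - ψ i x w| ≤ |q i x v - q i x w|) :
    ∫ x, ⨆ v, (g v + ∑ i, (∫ y, ψ i y v ∂(ν i) - ψ i (x i) v)) ∂(Measure.pi ν) ≤
      ∫ z, ⨆ v, (g v + ∑ i, sgn (z i).2 * q i (z i).1 v)
        ∂(Measure.pi fun i => (ν i).prod coin) := by
  induction m generalizing g with
  | zero => simp
  | succ m ih =>
    have hqs : ∀ i v, Integrable (fun z : E × Bool => sgn z.2 * q i z.1 v) ((ν i).prod coin) :=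
      fun i v => by simpa only [mul_comm] using (hq i v).mul_prod (integrable_coin sgn)
    have hpi : ∀ (i : Fin (m + 1)) {f : E → ℝ}, Integrable f (ν i) →
        Integrable (fun x : Fin (m + 1) → E => f (x i)) (Measure.pi ν) := fun i f hf =>
      (measurePreserving_eval ν i).integrable_comp_of_integrable hf
    have hpi' : ∀ (i : Fin m) {f : E × Bool → ℝ}, Integrable f ((ν i.succ).prod coin) →
        Integrable (fun x : Fin m → E × Bool => f (x i))
          (Measure.pi fun i : Fin m => (ν i.succ).prod coin) := fun i f hf =>
      (measurePreserving_eval (fun i : Fin m => (ν i.succ).prod coin) i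
        ).integrable_comp_of_integrable hf
    have hpi'' : ∀ (i : Fin (m + 1)) {f : E × Bool → ℝ}, Integrable f ((ν i).prod coin) →
        Integrable (fun x : Fin (m + 1) → E × Bool => f (x i))
          (Measure.pi fun i => (ν i).prod coin) := fun i f hf =>
      (measurePreserving_eval (fun i => (ν i).prod coin) i).integrable_comp_of_integrable hf
    have hL : Integrable (fun x : Fin (m + 1) → E =>
        ⨆ v, (g v + ∑ i, (∫ y, ψ i y v ∂(ν i) - ψ i (x i) v))) (Measure.pi ν) :=
      integrable_iSup fun v => (integrable_const _).add
        (integrable_finsetSum _ fun i _ => (integrable_const _).sub (hpi i (hψ i v)))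
    have hR : Integrable (fun z : Fin (m + 1) → E × Bool =>
        ⨆ v, (g v + ∑ i, sgn (z i).2 * q i (z i).1 v)) (Measure.pi fun i => (ν i).prod coin) :=
      integrable_iSup fun v => (integrable_const _).add
        (integrable_finsetSum _ fun i _ => hpi'' i (hqs i v))
    have hM : Integrable (fun p : E × (Fin m → E × Bool) =>
        ⨆ v, ((g v + (∫ y, ψ 0 y v ∂(ν 0) - ψ 0 p.1 v)) +
          ∑ i : Fin m, sgn (p.2 i).2 * q i.succ (p.2 i).1 v))
        ((ν 0).prod (Measure.pi fun i : Fin m => (ν i.succ).prod coin)) := by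
      refine integrable_iSup fun v => ((integrable_const _).add ((integrable_const _).sub
        ((hψ 0 v).comp_fst _))).add (integrable_finsetSum _ fun i _ => ?_)
      exact (hpi' i (hqs i.succ v)).comp_snd _
    have hR' := integrable_cons (fun i => (ν i).prod coin) hR
    rw [integral_pi_succ ν hL, integral_pi_succ _ hR]
    -- The free function `g` absorbs whatever is frozen: the first summand while induction treats
    -- the others, then, after Fubini, the signed sum of the others while the first is symmetrized.
    calc _ ≤ ∫ a, ∫ z, ⨆ v, ((g v + (∫ y, ψ 0 y v ∂(ν 0) - ψ 0 a v)) +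
          ∑ i : Fin m, sgn (z i).2 * q i.succ (z i).1 v)
          ∂(Measure.pi fun i : Fin m => (ν i.succ).prod coin) ∂(ν 0) := by
          refine integral_mono (integrable_cons ν hL).integral_prod_left hM.integral_prod_left
            fun a => ?_
          have := ih (fun i => ν i.succ) (ψ := fun i => ψ i.succ) (q := fun i => q i.succ)
            (fun v => g v + (∫ y, ψ 0 y v ∂(ν 0) - ψ 0 a v)) (fun i v => hψ _ v)
            (fun i v => hq _ v) (fun i x v w => h _ x v w)
          simpa only [Fin.sum_univ_succ, Fin.cons_zero, Fin.cons_succ, ← add_assoc] using this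
      _ = ∫ z, ∫ a, ⨆ v, ((g v + ∑ i : Fin m, sgn (z i).2 * q i.succ (z i).1 v) +
          (∫ y, ψ 0 y v ∂(ν 0) - ψ 0 a v)) ∂(ν 0)
          ∂(Measure.pi fun i : Fin m => (ν i.succ).prod coin) := by
          rw [integral_integral_swap hM]
          simp only [add_right_comm]
      _ ≤ ∫ z, ∫ b, ⨆ v, ((g v + ∑ i : Fin m, sgn (z i).2 * q i.succ (z i).1 v) +
          sgn b.2 * q 0 b.1 v) ∂((ν 0).prod coin)
          ∂(Measure.pi fun i : Fin m => (ν i.succ).prod coin) := by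
          refine integral_mono ?_ ?_ fun z =>
            integral_iSup_le_of_contraction _ (hψ 0) (hq 0) (h 0)
          · have := hM.integral_prod_right
            simpa only [add_right_comm] using this
          · have := hR'.integral_prod_right
            simpa only [Fin.sum_univ_succ, Fin.cons_zero, Fin.cons_succ, ← add_assoc,
              add_right_comm] using this
      _ = _ := by
          rw [integral_integral_swap]
          · simp only [Fin.sum_univ_succ, Fin.cons_zero, Fin.cons_succ]
            simp only [← add_assoc, add_right_comm]
          · have := hR'.swap
            simpa only [Fin.sum_univ_succ, Fin.cons_zero, Fin.cons_succ, ← add_assoc,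
              add_right_comm, Function.comp_def, Prod.swap, Function.uncurry_def] using this

end Symmetrization

/-! ### Even moments of sums of independent random variables with vanishing odd moments -/

section Moments

variable {Ω : Type*} [MeasurableSpace Ω] {μ : Measure Ω} [IsProbabilityMeasure μ]

lemma integrable_pow_of_memLp {X : Ω → ℝ} {p : ℕ} (hX : MemLp X p μ) {l : ℕ} (hl : l ≤ p) :
    Integrable (fun ω => X ω ^ l) μ := by
  have h : MemLp X l μ := hX.mono_exponent (by exact_mod_cast hl)
  have := h.integrable_norm_pow'
  refine this.mono (hX.aestronglyMeasurable.pow l) (Filter.Eventually.of_forall fun ω => ?_)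
  simp

/-- The even moments of a sum of two independent random variables, one of which has vanishing odd
moments. -/
lemma integral_add_pow_even {X Y : Ω → ℝ} (hXY : IndepFun X Y μ) {k : ℕ}
    (hX : MemLp X (2 * k : ℕ) μ) (hY : MemLp Y (2 * k : ℕ) μ)
    (hodd : ∀ l, Odd l → l ≤ 2 * k → ∫ ω, Y ω ^ l ∂μ = 0) :
    (∫ ω, (X ω + Y ω) ^ (2 * k) ∂μ) / (2 * k).factorial =
      ∑ j ∈ Finset.range (k + 1), (∫ ω, X ω ^ (2 * (k - j)) ∂μ) / (2 * (k - j)).factorial *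
        ((∫ ω, Y ω ^ (2 * j) ∂μ) / (2 * j).factorial) := by
  have hmul : ∀ l l', l ≤ 2 * k → l' ≤ 2 * k →
      Integrable (fun ω => X ω ^ l * Y ω ^ l') μ := fun l l' hl hl' =>
    (hXY.comp (measurable_id.pow_const l) (measurable_id.pow_const l')).integrable_mul
      (integrable_pow_of_memLp hX hl) (integrable_pow_of_memLp hY hl')
  have hinteg : ∀ l l', l ≤ 2 * k → l' ≤ 2 * k →
      ∫ ω, X ω ^ l * Y ω ^ l' ∂μ = (∫ ω, X ω ^ l ∂μ) * ∫ ω, Y ω ^ l' ∂μ := fun l l' hl hl' =>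
    (hXY.comp (measurable_id.pow_const l) (measurable_id.pow_const l')
      ).integral_fun_mul_eq_mul_integral
      (integrable_pow_of_memLp hX hl).aestronglyMeasurable
      (integrable_pow_of_memLp hY hl').aestronglyMeasurable
  have hexp : ∫ ω, (X ω + Y ω) ^ (2 * k) ∂μ = ∑ l ∈ Finset.range (2 * k + 1),
      (∫ ω, Y ω ^ l ∂μ) * (∫ ω, X ω ^ (2 * k - l) ∂μ) * ((2 * k).choose l : ℝ) := by
    simp_rw [add_comm (X _), add_pow]
    rw [integral_finsetSum]
    · refine Finset.sum_congr rfl fun l hl => ?_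
      have hl' : l ≤ 2 * k := by simpa [Nat.lt_succ_iff] using hl
      rw [integral_mul_const]
      simp_rw [mul_comm (Y _ ^ l)]
      rw [hinteg _ _ (Nat.sub_le _ _) hl', mul_comm (∫ ω, X ω ^ _ ∂μ)]
    · intro l hl
      have hl' : l ≤ 2 * k := by simpa [Nat.lt_succ_iff] using hl
      refine Integrable.mul_const ?_ _
      simpa only [mul_comm] using hmul _ _ (Nat.sub_le _ _) hl'
  -- Odd powers of `Y` integrate to zero, so the binomial sum lives on even indices; dividing by
  -- `(2k)!` turns it into a Cauchy product.
  have hsub : (Finset.range (k + 1)).image (fun j => 2 * j) ⊆ Finset.range (2 * k + 1) := by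
    intro l hl
    simp only [Finset.mem_image, Finset.mem_range] at hl ⊢
    omega
  rw [hexp, ← Finset.sum_subset hsub, Finset.sum_image (by intro a _ b _ h; simpa using h),
    Finset.sum_div]
  · refine Finset.sum_congr rfl fun j hj => ?_
    have hj' : j ≤ k := by simpa [Nat.lt_succ_iff] using hj
    rw [Nat.cast_choose ℝ (by omega : 2 * j ≤ 2 * k), ← Nat.mul_sub]
    have h1 : ((2 * k).factorial : ℝ) ≠ 0 := by positivity
    have h2 : ((2 * j).factorial : ℝ) ≠ 0 := by positivity
    have h3 : ((2 * (k - j)).factorial : ℝ) ≠ 0 := by positivity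
    field_simp
  · intro l hl hl2
    have hodd' : Odd l := by
      rw [← Nat.not_even_iff_odd]
      rintro ⟨j, rfl⟩
      refine hl2 (Finset.mem_image.2 ⟨j, ?_, by ring⟩)
      simp only [Finset.mem_range] at hl ⊢
      omega
    rw [hodd l hodd' (by simpa [Nat.lt_succ_iff] using hl)]
    simp

/-- Normalised even moments convolve under independent addition. Hence each new summand multiplies
the bound by at most `∑ c j ≤ G`, while the weights `d ^ j` are preserved by convolution. All
degrees `j ≤ k` must be carried through the induction at once. -/
lemma integral_sum_pow_even_le {ι : Type*} {z : ι → Ω → ℝ} (hz : iIndepFun z μ)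
    (hzm : ∀ i, Measurable (z i)) {k : ℕ} (hLp : ∀ i, MemLp (z i) (2 * k : ℕ) μ)
    (hodd : ∀ i l, Odd l → l ≤ 2 * k → ∫ ω, z i ω ^ l ∂μ = 0) {d G : ℝ} {c : ℕ → ℝ}
    (hd : 0 ≤ d) (hG : ∑ j ∈ Finset.range (k + 1), c j ≤ G) (hc : ∀ j, 0 ≤ c j)
    (heven : ∀ i, ∀ j ≤ k, (∫ ω, z i ω ^ (2 * j) ∂μ) / (2 * j).factorial ≤ d ^ j * c j)
    (hG1 : 1 ≤ G) (s : Finset ι) {j : ℕ} (hj : j ≤ k) :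
    (∫ ω, (∑ i ∈ s, z i ω) ^ (2 * j) ∂μ) / (2 * j).factorial ≤ d ^ j * G ^ s.card := by
  classical
  have hG0 : 0 ≤ G := zero_le_one.trans hG1
  induction s using Finset.induction_on generalizing j with
  | empty =>
    rcases Nat.eq_zero_or_pos j with rfl | hj0
    · simp
    · simp [hj0.ne', pow_nonneg hd]
  | insert a s ha ih =>
    have hle : ((2 * j : ℕ) : ENNReal) ≤ (2 * k : ℕ) := by
      exact_mod_cast Nat.mul_le_mul_left 2 hj
    have hLpj : ∀ i, MemLp (z i) (2 * j : ℕ) μ := fun i => (hLp i).mono_exponent hle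
    have hind : IndepFun (fun ω => ∑ i ∈ s, z i ω) (z a) μ := by
      have := hz.indepFun_finsetSum_of_notMem hzm ha
      convert this using 1
      ext ω; simp
    have hadd := integral_add_pow_even hind (k := j)
      (memLp_finsetSum s fun i _ => hLpj i) (hLpj a)
      (fun l hl hl' => hodd a l hl (hl'.trans (Nat.mul_le_mul_left 2 hj)))
    simp_rw [Finset.sum_insert ha, add_comm (z a _)]
    rw [hadd, Finset.card_insert_of_notMem ha]
    calc _ ≤ ∑ l ∈ Finset.range (j + 1), (d ^ (j - l) * G ^ s.card) * (d ^ l * c l) := by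
          refine Finset.sum_le_sum fun l hl => ?_
          have hl' : l ≤ j := by simpa [Nat.lt_succ_iff] using hl
          refine mul_le_mul (ih ((Nat.sub_le _ _).trans hj)) (heven a l (hl'.trans hj)) ?_ ?_
          · refine div_nonneg (integral_nonneg fun ω => ?_) (by positivity)
            simp only [Pi.zero_apply]
            rw [pow_mul]; positivity
          · positivity
      _ = d ^ j * G ^ s.card * ∑ l ∈ Finset.range (j + 1), c l := by
          rw [Finset.mul_sum]
          refine Finset.sum_congr rfl fun l hl => ?_
          have hl' : l ≤ j := by simpa [Nat.lt_succ_iff] using hl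
          rw [show d ^ j = d ^ (j - l) * d ^ l by rw [← pow_add, Nat.sub_add_cancel hl']]
          ring
      _ ≤ d ^ j * G ^ s.card * G := by
          refine mul_le_mul_of_nonneg_left (le_trans ?_ hG) (by positivity)
          exact Finset.sum_le_sum_of_subset_of_nonneg
            (Finset.range_mono (by omega)) fun l _ _ => hc l
      _ = d ^ j * G ^ (s.card + 1) := by ring

lemma factorial_two_mul_le (k : ℕ) : ((2 * k).factorial : ℝ) ≤ (4 * (k : ℝ) ^ 2) ^ k := by
  calc ((2 * k).factorial : ℝ) ≤ ((2 * k : ℕ) : ℝ) ^ (2 * k) := by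
        exact_mod_cast Nat.factorial_le_pow (2 * k)
    _ = (4 * (k : ℝ) ^ 2) ^ k := by rw [pow_mul]; push_cast; ring

lemma sum_geometric_weights_le (k : ℕ) {r : ℝ} (hr : 0 ≤ r) :
    ∑ j ∈ Finset.range (k + 1), (if j = 0 then 1 else r * (1 / 2) ^ j) ≤ 1 + r := by
  rw [Finset.sum_range_succ']
  simp only [Nat.succ_ne_zero, if_false, if_true, add_comm _ (1 : ℝ)]
  rw [← Finset.mul_sum]
  have h : ∑ j ∈ Finset.range k, (1 / 2 : ℝ) ^ (j + 1) ≤ 1 := by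
    have := sum_geometric_two_le k
    simp_rw [pow_succ]
    rw [← Finset.sum_mul]
    linarith
  nlinarith

/-- If the even moments of `m` independent random variables with vanishing odd moments satisfy
`𝔼 zᵢ^{2j} ≤ (2j)! (k/m) (d/2)^j` for `1 ≤ j ≤ k`, then `𝔼 (∑ zᵢ)^{2k} ≤ (4 e d k²)^k`. -/
lemma integral_sum_pow_even_le_of_geometric {m : ℕ} {z : Fin m → Ω → ℝ} (hz : iIndepFun z μ)
    (hm : 0 < m) (hzm : ∀ i, Measurable (z i)) {k : ℕ} (hLp : ∀ i, MemLp (z i) (2 * k : ℕ) μ)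
    (hodd : ∀ i l, Odd l → l ≤ 2 * k → ∫ ω, z i ω ^ l ∂μ = 0) {d : ℝ} (hd : 0 ≤ d)
    (heven : ∀ i j, 1 ≤ j → j ≤ k →
      (∫ ω, z i ω ^ (2 * j) ∂μ) / (2 * j).factorial ≤ d ^ j * (k / m * (1 / 2) ^ j)) :
    ∫ ω, (∑ i, z i ω) ^ (2 * k) ∂μ ≤ (4 * Real.exp 1 * d * k ^ 2) ^ k := by
  have hm' : (0 : ℝ) < m := by exact_mod_cast hm
  have hr : (0 : ℝ) ≤ k / m := by positivity
  have hG : 1 + (k : ℝ) / m ≤ Real.exp (k / m) := by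
    linarith [Real.add_one_le_exp ((k : ℝ) / m)]
  -- The weights sum to at most `1 + k / m ≤ exp (k / m)`, so all `m` summands together cost only
  -- `exp k`.
  have h := integral_sum_pow_even_le hz hzm hLp hodd (d := d) (G := Real.exp (k / m))
    (c := fun j => if j = 0 then 1 else (k : ℝ) / m * (1 / 2) ^ j) hd
    ((sum_geometric_weights_le k hr).trans hG)
    (fun j => by split_ifs <;> positivity)
    (fun i j hj => by
      rcases Nat.eq_zero_or_pos j with rfl | hj0
      · simp
      · simpa [hj0.ne'] using heven i j hj0 hj)
    (by linarith) Finset.univ le_rfl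
  rw [div_le_iff₀ (by positivity)] at h
  refine h.trans ?_
  rw [Finset.card_univ, Fintype.card_fin, ← Real.exp_nat_mul, mul_div_cancel₀ _ hm'.ne']
  calc d ^ k * Real.exp k * (2 * k).factorial
      ≤ d ^ k * Real.exp k * (4 * (k : ℝ) ^ 2) ^ k :=
        mul_le_mul_of_nonneg_left (factorial_two_mul_le k) (by positivity)
    _ = _ := by
        rw [← Real.exp_one_pow]
        simp only [← mul_pow]; ring

end Moments

/-! ### The norm of the `s` largest coordinates -/

section TopNorm

variable {n s : ℕ}

/-- The Euclidean norm of the `s` largest coordinates of a vector. -/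
def topNorm (s : ℕ) (h : Fin n → ℝ) : ℝ :=
  ⨆ S : {S : Finset (Fin n) // S.card = s}, √(∑ j ∈ S.1, h j ^ 2)

lemma nonempty_subsets_card (hs : s ≤ n) : Nonempty {S : Finset (Fin n) // S.card = s} := by
  obtain ⟨S, -, hS⟩ := Finset.exists_subset_card_eq
    (s := (Finset.univ : Finset (Fin n))) (n := s) (by simpa using hs)
  exact ⟨⟨S, hS⟩⟩

lemma sqrt_sum_le_topNorm (h : Fin n → ℝ) {S : Finset (Fin n)} (hS : S.card = s) :
    √(∑ j ∈ S, h j ^ 2) ≤ topNorm s h :=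
  le_iSup_of_finite (fun S : {S : Finset (Fin n) // S.card = s} => √(∑ j ∈ S.1, h j ^ 2)) ⟨S, hS⟩

lemma topNorm_nonneg (h : Fin n → ℝ) : 0 ≤ topNorm s h :=
  Real.iSup_nonneg fun _ => Real.sqrt_nonneg _

lemma measurable_topNorm : Measurable (topNorm s : (Fin n → ℝ) → ℝ) := by
  refine Measurable.iSup fun S => ?_
  fun_prop

lemma topNorm_add_le (hs : s ≤ n) (g h : Fin n → ℝ) :
    topNorm s (fun j => g j + h j) ≤ topNorm s g + topNorm s h := by
  have := nonempty_subsets_card hs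
  refine ciSup_le fun S => ?_
  have hg := sqrt_sum_le_topNorm g S.2
  have hh := sqrt_sum_le_topNorm h S.2
  refine le_trans ?_ (add_le_add hg hh)
  have hm := Real.Lp_add_le S.1 g h (p := 2) (by norm_num)
  simpa [Real.sqrt_eq_rpow] using hm

/-- A subset maximising the sum of squares works, since exchanging one index for another cannot
increase that sum. -/
lemma exists_largest_coordinates (hs : s ≤ n) (h : Fin n → ℝ) :
    ∃ J : Finset (Fin n), J.card = s ∧ ∀ i ∈ J, ∀ k ∉ J, h k ^ 2 ≤ h i ^ 2 := by
  classical
  have := nonempty_subsets_card hs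
  obtain ⟨J, hJ⟩ := Finite.exists_max
    fun S : {S : Finset (Fin n) // S.card = s} => ∑ j ∈ S.1, h j ^ 2
  refine ⟨J.1, J.2, fun i hi k hk => ?_⟩
  have hk' : k ∉ J.1.erase i := fun hmem => hk (Finset.mem_of_mem_erase hmem)
  have hcard : (insert k (J.1.erase i)).card = s := by
    rw [Finset.card_insert_of_notMem hk', Finset.card_erase_add_one hi, J.2]
  have hle := hJ ⟨_, hcard⟩
  simp only [Finset.sum_insert hk'] at hle
  have := Finset.sum_erase_add J.1 (fun j => h j ^ 2) hi
  linarith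

/-- Vectors of Euclidean norm at most one and of small `ℓ₁` norm are controlled, as linear
functionals, by the norm of the `s` largest coordinates. -/
lemma sum_mul_le_topNorm (hs1 : 1 ≤ s) (hs : s ≤ n) {r : ℝ} {v : Fin n → ℝ}
    (h2 : ∑ j, v j ^ 2 ≤ 1) (h1 : ∑ j, |v j| ≤ (1 + r) * √s) (h : Fin n → ℝ) :
    ∑ j, v j * h j ≤ (2 + r) * topNorm s h := by
  classical
  obtain ⟨J, hJs, hJ⟩ := exists_largest_coordinates hs h
  have hspos : (0 : ℝ) < s := by exact_mod_cast hs1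
  have htop := sqrt_sum_le_topNorm h hJs
  -- A coordinate outside `J` is dominated by every coordinate in `J`, hence by their root mean
  -- square. The `ℓ₁` bound on `v` then handles the outside part, and Cauchy–Schwarz the inside
  -- part.
  have hout : ∀ k ∉ J, |h k| ≤ topNorm s h / √s := fun k hk => by
    rw [le_div_iff₀ (Real.sqrt_pos.2 hspos), ← Real.sqrt_sq_eq_abs,
      ← Real.sqrt_mul (sq_nonneg _)]
    refine (Real.sqrt_le_sqrt ?_).trans htop
    calc h k ^ 2 * s = ∑ _j ∈ J, h k ^ 2 := by
          rw [Finset.sum_const, hJs, nsmul_eq_mul, mul_comm]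
      _ ≤ _ := Finset.sum_le_sum fun i hi => hJ i hi k hk
  have hin : ∑ j ∈ J, v j * h j ≤ topNorm s h := by
    refine (Real.sum_mul_le_sqrt_mul_sqrt J v h).trans ?_
    have hv : √(∑ j ∈ J, v j ^ 2) ≤ 1 := by
      rw [Real.sqrt_le_one]
      exact (Finset.sum_le_univ_sum_of_nonneg fun j => sq_nonneg _).trans h2
    calc _ ≤ 1 * √(∑ j ∈ J, h j ^ 2) :=
          mul_le_mul_of_nonneg_right hv (Real.sqrt_nonneg _)
      _ ≤ _ := by rw [one_mul]; exact htop
  have hout' : ∑ j ∈ Jᶜ, v j * h j ≤ (1 + r) * topNorm s h := by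
    have hnn : 0 ≤ topNorm s h / √s := div_nonneg (topNorm_nonneg h) (Real.sqrt_nonneg _)
    calc ∑ j ∈ Jᶜ, v j * h j ≤ ∑ j ∈ Jᶜ, |v j| * (topNorm s h / √s) := by
          refine Finset.sum_le_sum fun j hj => (le_abs_self _).trans ?_
          rw [abs_mul]
          exact mul_le_mul_of_nonneg_left (hout j (Finset.mem_compl.1 hj)) (abs_nonneg _)
      _ ≤ (∑ j, |v j|) * (topNorm s h / √s) := by
          rw [← Finset.sum_mul]
          exact mul_le_mul_of_nonneg_right
            (Finset.sum_le_univ_sum_of_nonneg fun j => abs_nonneg _) hnn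
      _ ≤ (1 + r) * √s * (topNorm s h / √s) := mul_le_mul_of_nonneg_right h1 hnn
      _ = _ := by field_simp
  rw [← Finset.sum_add_sum_compl J]
  linarith

/-- The power mean inequality on the optimal `s`-subset, whose sum of powers is then enlarged to all
coordinates. This replaces a union bound over subsets. -/
lemma topNorm_pow_le (hs : s ≤ n) {k : ℕ} (hk : 1 ≤ k) (h : Fin n → ℝ) :
    topNorm s h ^ (2 * k) ≤ (s : ℝ) ^ (k - 1) * ∑ j, h j ^ (2 * k) := by
  have := nonempty_subsets_card hs
  obtain ⟨S, hS⟩ := exists_eq_ciSup_of_finite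
    (f := fun S : {S : Finset (Fin n) // S.card = s} => √(∑ j ∈ S.1, h j ^ 2))
  rw [topNorm, ← hS, pow_mul, Real.sq_sqrt (Finset.sum_nonneg fun j _ => sq_nonneg _)]
  obtain ⟨l, rfl⟩ := Nat.exists_eq_add_of_le' hk
  have hle : (∑ j ∈ S.1, h j ^ 2) ^ (l + 1) ≤
      (s : ℝ) ^ l * ∑ j ∈ S.1, (h j ^ 2) ^ (l + 1) := by
    have := pow_sum_le_card_mul_sum_pow (s := S.1) (f := fun j => h j ^ 2)
      (fun j _ => sq_nonneg _) l
    simpa only [S.2] using this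
  refine hle.trans ?_
  simp only [← pow_mul, Nat.add_sub_cancel]
  refine mul_le_mul_of_nonneg_left ?_ (by positivity)
  exact Finset.sum_le_univ_sum_of_nonneg fun j => by rw [pow_mul]; positivity

/-- Jensen's inequality in the power `2 * k`. Summing over all `n` coordinates costs `(n / s) ^ (1 /
(2 * k))`, which is the factor `D`; this is bounded once `k` is of order `log (e n / s)`. -/
lemma integral_topNorm_le {Ω : Type*} [MeasurableSpace Ω] {μ : Measure Ω}
    [IsProbabilityMeasure μ] (hs1 : 1 ≤ s) (hs : s ≤ n) {k : ℕ} (hk : 1 ≤ k)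
    {h : Fin n → Ω → ℝ} (hm : ∀ j, Measurable (h j))
    (hinteg : ∀ j, Integrable (fun ω => h j ω ^ (2 * k)) μ) {A D : ℝ} (hA : 0 ≤ A) (hD : 0 ≤ D)
    (hhA : ∀ j, ∫ ω, h j ω ^ (2 * k) ∂μ ≤ A ^ (2 * k)) (hn : (n : ℝ) ≤ s * D ^ (2 * k)) :
    Integrable (fun ω => topNorm s fun j => h j ω) μ ∧
    ∫ ω, topNorm s (fun j => h j ω) ∂μ ≤ √s * D * A := by
  have hmeas : Measurable fun ω => topNorm s fun j => h j ω :=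
    measurable_topNorm.comp (measurable_pi_iff.2 hm)
  have hsum : Integrable (fun ω => (s : ℝ) ^ (k - 1) * ∑ j, h j ω ^ (2 * k)) μ :=
    (integrable_finsetSum _ fun j _ => hinteg j).const_mul _
  have hpow : Integrable (fun ω => (topNorm s fun j => h j ω) ^ (2 * k)) μ :=
    hsum.mono' (hmeas.pow_const _).aestronglyMeasurable (Filter.Eventually.of_forall fun ω => by
      rw [Real.norm_of_nonneg (pow_nonneg (topNorm_nonneg _) _)]
      exact topNorm_pow_le hs hk _)
  have hone : Integrable (fun ω => topNorm s fun j => h j ω) μ := by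
    refine ((integrable_const (1 : ℝ)).add hpow).mono' hmeas.aestronglyMeasurable
      (Filter.Eventually.of_forall fun ω => ?_)
    rw [Real.norm_of_nonneg (topNorm_nonneg _)]
    set x := topNorm s fun j => h j ω
    have hx : 0 ≤ x := topNorm_nonneg _
    rcases le_total x 1 with h1 | h1
    · exact h1.trans (by simp only [Pi.add_apply]; linarith [pow_nonneg hx (2 * k)])
    · have := le_self_pow₀ h1 (by omega : 2 * k ≠ 0)
      simp only [Pi.add_apply]; linarith
  refine ⟨hone, ?_⟩
  have hjensen : (∫ ω, topNorm s (fun j => h j ω) ∂μ) ^ (2 * k) ≤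
      ∫ ω, (topNorm s fun j => h j ω) ^ (2 * k) ∂μ :=
    (convexOn_pow (2 * k)).map_integral_le (continuousOn_pow _) isClosed_Ici
      (Filter.Eventually.of_forall fun ω => topNorm_nonneg _) hone hpow
  refine le_of_pow_le_pow_left₀ (by omega : 2 * k ≠ 0) (by positivity) (hjensen.trans ?_)
  calc _ ≤ ∫ ω, (s : ℝ) ^ (k - 1) * ∑ j, h j ω ^ (2 * k) ∂μ :=
        integral_mono hpow hsum fun ω => topNorm_pow_le hs hk _
    _ ≤ (s : ℝ) ^ (k - 1) * (n * A ^ (2 * k)) := by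
        rw [integral_const_mul, integral_finsetSum _ fun j _ => hinteg j]
        refine mul_le_mul_of_nonneg_left ?_ (by positivity)
        refine (Finset.sum_le_sum fun j _ => hhA j).trans_eq ?_
        simp
    _ ≤ (s : ℝ) ^ (k - 1) * (s * D ^ (2 * k) * A ^ (2 * k)) := by gcongr
    _ = (√s * D * A) ^ (2 * k) := by
        rw [mul_pow, mul_pow, pow_mul √(s : ℝ), Real.sq_sqrt (by positivity)]
        obtain ⟨l, rfl⟩ := Nat.exists_eq_add_of_le' hk
        rw [Nat.add_sub_cancel, pow_succ (s : ℝ)]; ring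

lemma topNorm_le_mul_locFrob {m : ℕ} (hs : s ≤ n) (B : Matrix (Fin m) (Fin n) ℝ)
    {g : Fin n → ℝ} (hg : ∀ j, g j ^ 2 ≤ m * ∑ i, B i j ^ 2) :
    topNorm s g ≤ √m * locFrob B s := by
  have := nonempty_subsets_card hs
  refine ciSup_le fun S => ?_
  have hS := le_iSup_of_finite
    (fun S : {S : Finset (Fin n) // S.card = s} => √(∑ j ∈ S.1, ∑ i, B i j ^ 2)) S
  refine le_trans ?_ (mul_le_mul_of_nonneg_left hS (Real.sqrt_nonneg _))
  rw [← Real.sqrt_mul (by positivity), Finset.mul_sum]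
  exact Real.sqrt_le_sqrt (Finset.sum_le_sum fun j _ => hg j)

end TopNorm

/-! ### Truncated second moments of linear forms -/

section SmallBall

variable {Ω : Type*} [MeasurableSpace Ω] {μ : Measure Ω}

lemma IndepFun.integral_pow_mul_pow {X Y : Ω → ℝ} (hXY : IndepFun X Y μ)
    (hX : AEStronglyMeasurable X μ) (hY : AEStronglyMeasurable Y μ) (a b : ℕ) :
    ∫ ω, X ω ^ a * Y ω ^ b ∂μ = (∫ ω, X ω ^ a ∂μ) * ∫ ω, Y ω ^ b ∂μ :=
  (hXY.comp (measurable_id.pow_const a) (measurable_id.pow_const b)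
    ).integral_fun_mul_eq_mul_integral (hX.pow a) (hY.pow b)

variable [IsProbabilityMeasure μ]

lemma IndepFun.integrable_pow_mul_pow {X Y : Ω → ℝ} (hXY : IndepFun X Y μ) {p : ℕ}
    (hX : MemLp X p μ) (hY : MemLp Y p μ) {a b : ℕ} (ha : a ≤ p) (hb : b ≤ p) :
    Integrable (fun ω => X ω ^ a * Y ω ^ b) μ :=
  (hXY.comp (measurable_id.pow_const a) (measurable_id.pow_const b)).integrable_mul
    (integrable_pow_of_memLp hX ha) (integrable_pow_of_memLp hY hb)

lemma integral_add_sq_of_indepFun {X Y : Ω → ℝ} (hXY : IndepFun X Y μ)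
    (hX : MemLp X (4 : ℕ) μ) (hY : MemLp Y (4 : ℕ) μ) (hY0 : ∫ ω, Y ω ∂μ = 0) :
    ∫ ω, (X ω + Y ω) ^ 2 ∂μ = ∫ ω, X ω ^ 2 ∂μ + ∫ ω, Y ω ^ 2 ∂μ := by
  have h11 := IndepFun.integral_pow_mul_pow hXY hX.1 hY.1 1 1
  have i11 := IndepFun.integrable_pow_mul_pow hXY hX hY (a := 1) (b := 1) (by norm_num)
    (by norm_num)
  have iX := integrable_pow_of_memLp hX (l := 2) (by norm_num)
  have iY := integrable_pow_of_memLp hY (l := 2) (by norm_num)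
  simp only [pow_one, hY0, mul_zero] at h11 i11
  have : ∀ ω, (X ω + Y ω) ^ 2 = (X ω ^ 2 + Y ω ^ 2) + 2 * (X ω * Y ω) := fun ω => by ring
  simp_rw [this]
  rw [integral_add (iX.fun_add iY) (i11.const_mul 2), integral_add iX iY, integral_const_mul, h11]
  ring

lemma integral_add_pow_four_of_indepFun {X Y : Ω → ℝ} (hXY : IndepFun X Y μ)
    (hX : MemLp X (4 : ℕ) μ) (hY : MemLp Y (4 : ℕ) μ) (hX0 : ∫ ω, X ω ∂μ = 0)
    (hY0 : ∫ ω, Y ω ∂μ = 0) :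
    ∫ ω, (X ω + Y ω) ^ 4 ∂μ = ∫ ω, X ω ^ 4 ∂μ +
      6 * ((∫ ω, X ω ^ 2 ∂μ) * ∫ ω, Y ω ^ 2 ∂μ) + ∫ ω, Y ω ^ 4 ∂μ := by
  have h13 := IndepFun.integral_pow_mul_pow hXY hX.1 hY.1 1 3
  have h22 := IndepFun.integral_pow_mul_pow hXY hX.1 hY.1 2 2
  have h31 := IndepFun.integral_pow_mul_pow hXY hX.1 hY.1 3 1
  have i13 := IndepFun.integrable_pow_mul_pow hXY hX hY (a := 1) (b := 3) (by norm_num)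
    (by norm_num)
  have i22 := IndepFun.integrable_pow_mul_pow hXY hX hY (a := 2) (b := 2) (by norm_num)
    (by norm_num)
  have i31 := IndepFun.integrable_pow_mul_pow hXY hX hY (a := 3) (b := 1) (by norm_num)
    (by norm_num)
  have iX := integrable_pow_of_memLp hX (l := 4) (by norm_num)
  have iY := integrable_pow_of_memLp hY (l := 4) (by norm_num)
  simp only [pow_one, hX0, hY0, mul_zero, zero_mul] at h13 h31 i13 i31
  have : ∀ ω, (X ω + Y ω) ^ 4 = ((X ω ^ 4 + 6 * (X ω ^ 2 * Y ω ^ 2)) + Y ω ^ 4) +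
      4 * (X ω * Y ω ^ 3 + X ω ^ 3 * Y ω) := fun ω => by ring
  simp_rw [this]
  rw [integral_add ((iX.fun_add (i22.const_mul 6)).fun_add iY) ((i13.fun_add i31).const_mul 4),
    integral_add (iX.fun_add (i22.const_mul 6)) iY, integral_add iX (i22.const_mul 6),
    integral_const_mul, integral_const_mul, integral_add i13 i31, h13, h22, h31]
  ring

/-- Third-order cross terms vanish by centring. The constant `3` reproduces itself in the induction:
the cross term `6 σ₂²` is at most `6 μ₄`, exactly the cross term of `3 μ₄ (a + b)²`. -/
lemma integral_linearForm_moments {ι : Type*} {y : ι → Ω → ℝ} (hy : iIndepFun y μ)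
    (hym : ∀ j, Measurable (y j)) (hLp : ∀ j, MemLp (y j) (4 : ℕ) μ)
    (hy0 : ∀ j, ∫ ω, y j ω ∂μ = 0) {σ₂ μ₄ : ℝ} (h2 : ∀ j, ∫ ω, y j ω ^ 2 ∂μ = σ₂)
    (h4 : ∀ j, ∫ ω, y j ω ^ 4 ∂μ ≤ μ₄) (hσ : σ₂ ^ 2 ≤ μ₄) (v : ι → ℝ) (s : Finset ι) :
    MemLp (fun ω => ∑ j ∈ s, v j * y j ω) (4 : ℕ) μ ∧
    ∫ ω, ∑ j ∈ s, v j * y j ω ∂μ = 0 ∧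
    ∫ ω, (∑ j ∈ s, v j * y j ω) ^ 2 ∂μ = σ₂ * ∑ j ∈ s, v j ^ 2 ∧
    ∫ ω, (∑ j ∈ s, v j * y j ω) ^ 4 ∂μ ≤ 3 * μ₄ * (∑ j ∈ s, v j ^ 2) ^ 2 := by
  classical
  have hvLp : ∀ j, MemLp (fun ω => v j * y j ω) (4 : ℕ) μ := fun j => (hLp j).const_mul (v j)
  have hv0 : ∀ j, ∫ ω, v j * y j ω ∂μ = 0 := fun j => by rw [integral_const_mul, hy0, mul_zero]
  have hvi : iIndepFun (fun j ω => v j * y j ω) μ :=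
    hy.comp (fun j x => v j * x) fun j => measurable_const_mul (v j)
  induction s using Finset.induction_on with
  | empty => simp
  | insert a s ha ih =>
    obtain ⟨ih1, ih0, ih2, ih4⟩ := ih
    have hind : IndepFun (fun ω => ∑ j ∈ s, v j * y j ω) (fun ω => v a * y a ω) μ := by
      have := hvi.indepFun_finsetSum_of_notMem (fun j => (hym j).const_mul _) ha
      convert this using 1
      ext ω; simp
    have hinteg : ∀ {f : Ω → ℝ}, MemLp f (4 : ℕ) μ → Integrable f μ := fun hf =>
      hf.integrable (by norm_num)
    simp_rw [Finset.sum_insert ha, add_comm (v a * y a _)]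
    refine ⟨ih1.add (hvLp a), ?_, ?_, ?_⟩
    · rw [integral_add (hinteg ih1) (hinteg (hvLp a)), ih0, hv0, add_zero]
    · rw [integral_add_sq_of_indepFun hind ih1 (hvLp a) (hv0 a), ih2]
      simp_rw [mul_pow]
      rw [integral_const_mul, h2]; ring
    · rw [integral_add_pow_four_of_indepFun hind ih1 (hvLp a) ih0 (hv0 a), ih2]
      simp_rw [mul_pow]
      rw [integral_const_mul, integral_const_mul, h2]
      have hw : 0 ≤ ∑ j ∈ s, v j ^ 2 := Finset.sum_nonneg fun j _ => sq_nonneg _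
      have e1 : v a ^ 4 * ∫ ω, y a ω ^ 4 ∂μ ≤ v a ^ 4 * μ₄ :=
        mul_le_mul_of_nonneg_left (h4 a) (by positivity)
      have e2 : (∑ j ∈ s, v j ^ 2) * v a ^ 2 * σ₂ ^ 2 ≤ (∑ j ∈ s, v j ^ 2) * v a ^ 2 * μ₄ :=
        mul_le_mul_of_nonneg_left hσ (by positivity)
      have e3 : 0 ≤ v a ^ 4 * μ₄ := mul_nonneg (by positivity) ((sq_nonneg _).trans hσ)
      nlinarith

/-- A minorant of the truncated square that is polynomial in `t`, so its mean is read off from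
second and fourth moments. The bound by `H` is `(l * t ^ 2 - 2 * H) ^ 2 ≥ 0`. -/
lemma le_min_sq {l H : ℝ} (hl1 : l ≤ 1) (hH : 0 < H) (t : ℝ) :
    l * t ^ 2 - l ^ 2 * t ^ 4 / (4 * H) ≤ min (t ^ 2) H := by
  have h0 : 0 ≤ l ^ 2 * t ^ 4 / (4 * H) := by positivity
  refine le_min ?_ ?_
  · nlinarith [sq_nonneg t]
  · rw [sub_le_iff_le_add, ← sub_le_iff_le_add', le_div_iff₀ (by positivity)]
    nlinarith [sq_nonneg (l * t ^ 2 - 2 * H)]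

/-- A centred variable with comparable second and fourth moments, shifted by any constant, keeps
half of its variance after truncation. -/
lemma half_variance_le_integral_min_sq {Y : Ω → ℝ} (hY : MemLp Y (4 : ℕ) μ)
    (hY0 : ∫ ω, Y ω ∂μ = 0) {σ₂ μ₄ : ℝ} (hσ0 : 0 < σ₂) (hY2 : ∫ ω, Y ω ^ 2 ∂μ = σ₂)
    (hY4 : ∫ ω, Y ω ^ 4 ∂μ ≤ 3 * μ₄) (hσ : σ₂ ^ 2 ≤ μ₄) (β : ℝ) :
    σ₂ / 2 ≤ ∫ ω, min ((β + Y ω) ^ 2) (16 * μ₄ / σ₂) ∂μ := by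
  have hμ : 0 < μ₄ := lt_of_lt_of_le (by positivity) hσ
  set e : ℝ := β ^ 2 + σ₂
  have he : 0 < e := by positivity
  -- This makes `l` times the second moment `e` of `β + Y` equal to `σ₂`, independently of the shift
  -- `β`.
  set l : ℝ := σ₂ / e
  have hl1 : l ≤ 1 := by
    rw [div_le_one he]; simp only [e]; nlinarith [sq_nonneg β]
  set H : ℝ := 16 * μ₄ / σ₂
  have hH : 0 < H := by positivity
  have i1 : Integrable Y μ := hY.integrable (by norm_num)
  have i2 := integrable_pow_of_memLp hY (l := 2) (by norm_num)
  have i4 := integrable_pow_of_memLp hY (l := 4) (by norm_num)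
  have hZ : MemLp (fun ω => β + Y ω) (4 : ℕ) μ := (memLp_const β).add hY
  have j2 := integrable_pow_of_memLp hZ (l := 2) (by norm_num)
  have j4 := integrable_pow_of_memLp hZ (l := 4) (by norm_num)
  have hZ2 : ∫ ω, (β + Y ω) ^ 2 ∂μ = e := by
    have : ∀ ω, (β + Y ω) ^ 2 = (β ^ 2 + 2 * β * Y ω) + Y ω ^ 2 := fun ω => by ring
    simp_rw [this]
    rw [integral_add ((integrable_const _).fun_add (i1.const_mul _)) i2,
      integral_add (integrable_const _) (i1.const_mul _), integral_const_mul, hY0, hY2]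
    simp [e]
  have hZ4 : ∫ ω, (β + Y ω) ^ 4 ∂μ ≤ 8 * β ^ 4 + 24 * μ₄ := by
    calc ∫ ω, (β + Y ω) ^ 4 ∂μ ≤ ∫ ω, (8 * β ^ 4 + 8 * Y ω ^ 4) ∂μ := by
          refine integral_mono j4 ((integrable_const _).add (i4.const_mul _)) fun ω => ?_
          simp only
          nlinarith [sq_nonneg (β - Y ω), sq_nonneg (β ^ 2 - Y ω ^ 2), sq_nonneg (β + Y ω),
            sq_nonneg ((β - Y ω) * (β + Y ω)), sq_nonneg ((β - Y ω) ^ 2),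
            mul_nonneg (sq_nonneg (β - Y ω)) (sq_nonneg (β + Y ω)),
            mul_nonneg (sq_nonneg (β - Y ω)) (sq_nonneg β),
            mul_nonneg (sq_nonneg (β - Y ω)) (sq_nonneg (Y ω))]
      _ ≤ _ := by
          rw [integral_add (integrable_const _) (i4.const_mul 8),
            integral_const_mul 8 fun ω => Y ω ^ 4]
          simp only [integral_const, probReal_univ, one_smul]
          linarith
  have hmin : Integrable (fun ω => min ((β + Y ω) ^ 2) H) μ := j2.inf (integrable_const _)
  calc σ₂ / 2 ≤ l * e - l ^ 2 * (8 * β ^ 4 + 24 * μ₄) / (4 * H) := by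
        have h1 : l * e = σ₂ := div_mul_cancel₀ _ he.ne'
        rw [h1]
        -- The source of the `16` in `H`: since `l * β ^ 2 ≤ σ₂` and `l ≤ 1`, the numerator is at
        -- most `8 σ₂² + 24 μ₄ ≤ 32 μ₄`.
        have h2 : l ^ 2 * (8 * β ^ 4 + 24 * μ₄) / (4 * H) ≤ σ₂ / 2 := by
          rw [div_le_iff₀ (by positivity)]
          have h3 : σ₂ / 2 * (4 * H) = 32 * μ₄ := by simp only [H]; field_simp; ring
          rw [h3, div_pow, div_mul_eq_mul_div, div_le_iff₀ (by positivity)]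
          simp only [e]
          nlinarith [mul_le_mul_of_nonneg_right hσ (by positivity : 0 ≤ 8 * β ^ 4),
            mul_nonneg (mul_nonneg hμ.le (sq_nonneg β)) hσ0.le,
            mul_nonneg hμ.le (sq_nonneg (β ^ 2)), mul_nonneg hμ.le (sq_nonneg σ₂)]
        linarith
    _ ≤ ∫ ω, (l * (β + Y ω) ^ 2 - l ^ 2 / (4 * H) * (β + Y ω) ^ 4) ∂μ := by
        rw [integral_sub (j2.const_mul _) (j4.const_mul _), integral_const_mul,
          integral_const_mul, hZ2, mul_div_right_comm]
        have : l ^ 2 / (4 * H) * ∫ ω, (β + Y ω) ^ 4 ∂μ ≤ l ^ 2 / (4 * H) * (8 * β ^ 4 + 24 * μ₄) :=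
          mul_le_mul_of_nonneg_left hZ4 (by positivity)
        linarith
    _ ≤ _ := by
        refine integral_mono ((j2.const_mul _).sub (j4.const_mul _)) hmin fun ω => ?_
        have := le_min_sq hl1 hH (β + Y ω)
        rwa [mul_div_right_comm] at this

/-- The truncated square is the square of `min |x| √H`, so a difference of squares factors. This
Lipschitz bound feeds the contraction principle. -/
lemma abs_min_sq_sub_min_sq_le {H : ℝ} (hH : 0 ≤ H) (a b : ℝ) :
    |min (a ^ 2) H - min (b ^ 2) H| ≤ 2 * √H * |a - b| := by
  have key : ∀ x : ℝ, min (x ^ 2) H = min |x| √H ^ 2 := fun x => by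
    rcases le_total |x| √H with h | h
    · rw [min_eq_left h, sq_abs, min_eq_left]
      rw [← sq_abs]; exact (Real.le_sqrt (abs_nonneg _) hH).1 h
    · rw [min_eq_right h, Real.sq_sqrt hH, min_eq_right]
      rw [← sq_abs]; exact (Real.sqrt_le_left (abs_nonneg _)).1 h
  rw [key, key, sq_sub_sq, abs_mul]
  have h1 : |min |a| √H + min |b| √H| ≤ 2 * √H := by
    rw [abs_of_nonneg (by positivity)]
    linarith [min_le_right |a| √H, min_le_right |b| √H]
  have h2 : |min |a| √H - min |b| √H| ≤ |a - b| :=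
    (abs_min_sub_min_le_max _ _ _ _).trans (by simpa using abs_abs_sub_abs_le_abs_sub a b)
  exact mul_le_mul h1 h2 (abs_nonneg _) (by positivity)

/-- The second moment is controlled by the first and the fourth. -/
lemma variance_le_of_first_fourth {X : Ω → ℝ} (hX : MemLp X (4 : ℕ) μ) {σ₂ μ₄ κ : ℝ}
    (h1 : ∫ ω, |X ω| ∂μ ≤ κ) (h2 : ∫ ω, X ω ^ 2 ∂μ = σ₂) (h4 : ∫ ω, X ω ^ 4 ∂μ ≤ μ₄)
    (hσ0 : 0 < σ₂) (hμ : 0 < μ₄) : √σ₂ ≤ 3 * κ * (√μ₄ / σ₂) := by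
  have i1 : Integrable (fun ω => |X ω|) μ := (hX.integrable (by norm_num)).abs
  have i2 := integrable_pow_of_memLp hX (l := 2) (by norm_num)
  have i4 := integrable_pow_of_memLp hX (l := 4) (by norm_num)
  have hκ : 0 ≤ κ := (integral_nonneg fun ω => abs_nonneg _).trans h1
  have key : ∀ a : ℝ, 0 < a → σ₂ ≤ a * κ + μ₄ / a ^ 2 := fun a ha => by
    calc σ₂ = ∫ ω, X ω ^ 2 ∂μ := h2.symm
      _ ≤ ∫ ω, (a * |X ω| + 1 / a ^ 2 * X ω ^ 4) ∂μ := by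
          refine integral_mono i2 ((i1.const_mul _).add (i4.const_mul _)) fun ω => ?_
          simp only
          rcases le_total |X ω| a with h | h
          · have : X ω ^ 2 ≤ a * |X ω| := by
              rw [← sq_abs, sq]; exact mul_le_mul_of_nonneg_right h (abs_nonneg _)
            have : 0 ≤ 1 / a ^ 2 * X ω ^ 4 := by positivity
            linarith
          · have h' : a ^ 2 ≤ X ω ^ 2 := by rw [← sq_abs (X ω)]; gcongr
            have : X ω ^ 2 ≤ 1 / a ^ 2 * X ω ^ 4 := by
              rw [one_div_mul_eq_div, le_div_iff₀ (by positivity)]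
              nlinarith [sq_nonneg (X ω)]
            have : 0 ≤ a * |X ω| := by positivity
            linarith
      _ ≤ a * κ + μ₄ / a ^ 2 := by
          rw [integral_add (i1.const_mul _) (i4.const_mul _), integral_const_mul,
            integral_const_mul]
          have e1 := mul_le_mul_of_nonneg_left h1 ha.le
          have e2 := mul_le_mul_of_nonneg_left h4 (by positivity : 0 ≤ 1 / a ^ 2)
          have e3 : 1 / a ^ 2 * μ₄ = μ₄ / a ^ 2 := by ring
          linarith
  have hs : 0 < √σ₂ := Real.sqrt_pos.2 hσ0
  have hm : 0 < √μ₄ := Real.sqrt_pos.2 hμ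
  have hs2 : √σ₂ ^ 2 = σ₂ := Real.sq_sqrt hσ0.le
  have hm2 : √μ₄ ^ 2 = μ₄ := Real.sq_sqrt hμ.le
  -- At this splitting level the fourth-moment term is `4 / 9 * σ₂` and can be absorbed on the left.
  have h := key (3 / 2 * (√μ₄ / √σ₂)) (by positivity)
  have e : μ₄ / (3 / 2 * (√μ₄ / √σ₂)) ^ 2 = 4 / 9 * σ₂ := by
    rw [mul_pow, div_pow √μ₄, hm2, hs2]; field_simp; norm_num
  rw [e] at h
  have h' : 5 / 9 * σ₂ * √σ₂ ≤ 3 / 2 * √μ₄ * κ := by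
    have : 5 / 9 * σ₂ ≤ 3 / 2 * (√μ₄ * κ) / √σ₂ := by
      calc 5 / 9 * σ₂ ≤ 3 / 2 * (√μ₄ / √σ₂) * κ := by linarith
        _ = _ := by ring
    rw [le_div_iff₀ hs] at this
    linarith
  rw [← mul_div_assoc, le_div_iff₀ hσ0]
  nlinarith [mul_nonneg hκ hm.le]

end SmallBall

/-! ### Uniform lower bounds for sums of nonnegative bounded functions -/

section UniformLowerBound

variable {E : Type*} [MeasurableSpace E] {m : ℕ} {H a : ℝ}

/-- McDiarmid applied to the largest deficit, which changes by at most `H` when one row is replaced.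
Of the total mean `m * a`, one quarter is spent on the expected deficit and one quarter on its
fluctuation. -/
lemma measureReal_forall_le_sum_of_finite {ι : Type*} [Finite ι] [Nonempty ι]
    (ν : Fin m → Measure E) [∀ i, IsProbabilityMeasure (ν i)] {φ : Fin m → E → ι → ℝ}
    (hφm : ∀ i v, Measurable fun x => φ i x v) (hφ0 : ∀ i x v, 0 ≤ φ i x v)
    (hφH : ∀ i x v, φ i x v ≤ H) (hm : 0 < m) (hH : 0 < H) (ha : 0 ≤ a)
    (hmean : ∀ i v, a ≤ ∫ x, φ i x v ∂(ν i))
    (hsup : ∫ x, ⨆ v, ∑ i, (∫ y, φ i y v ∂(ν i) - φ i (x i) v) ∂(Measure.pi ν) ≤ m * a / 4) :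
    1 - Real.exp (-(m * a ^ 2 / (8 * H ^ 2))) ≤
      (Measure.pi ν).real {x | ∀ v, m * a / 2 ≤ ∑ i, φ i (x i) v} := by
  have hm' : (0 : ℝ) < m := by exact_mod_cast hm
  set f : (Fin m → E) → ℝ := fun x => ⨆ v, ∑ i, (∫ y, φ i y v ∂(ν i) - φ i (x i) v)
  have hφi : ∀ i v, Integrable (fun x => φ i x v) (ν i) := fun i v =>
    integrable_of_abs_le (hφm i v) H fun x => by
      rw [abs_of_nonneg (hφ0 i x v)]; exact hφH i x v
  have hmean0 : ∀ i v, 0 ≤ ∫ y, φ i y v ∂(ν i) := fun i v => integral_nonneg fun y => hφ0 i y v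
  have hmeanH : ∀ i v, ∫ y, φ i y v ∂(ν i) ≤ H := fun i v => by
    refine (integral_mono (hφi i v) (integrable_const H) fun y => hφH i y v).trans_eq ?_
    simp
  have hfm : Measurable f := by
    refine Measurable.iSup fun v => Finset.measurable_sum _ fun i _ => ?_
    exact measurable_const.sub ((hφm i v).comp (measurable_pi_apply i))
  have hfb : ∀ x, |f x| ≤ m * H := fun x => by
    refine abs_iSup_le fun v => (Finset.abs_sum_le_sum_abs _ _).trans ?_
    refine (Finset.sum_le_sum fun i _ => (?_ : _ ≤ H)).trans_eq (by simp)
    rw [abs_le]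
    constructor <;> linarith [hφ0 i (x i) v, hφH i (x i) v, hmean0 i v, hmeanH i v]
  have hfc : ∀ (x : Fin m → E) (i : Fin m) (b : E), f x - f (Function.update x i b) ≤ H := by
    intro x i b
    rw [sub_le_iff_le_add']
    refine iSup_le_iSup_add fun v => ?_
    rw [Finset.sum_sub_distrib, Finset.sum_sub_distrib]
    have h : ∑ k, φ k (Function.update x i b k) v - ∑ k, φ k (x k) v ≤ H := by
      rw [← Finset.sum_sub_distrib, Finset.sum_eq_single i]
      · rw [Function.update_self]; linarith [hφH i b v, hφ0 i (x i) v]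
      · intro k _ hk; rw [Function.update_of_ne hk, sub_self]
      · simp
    linarith
  have hmc := measureReal_ge_le_of_bounded_differences ν hfm hfb hfc hm hH
    (r := m * a / 4) (by positivity)
  have hexp : 2 * (m * a / 4) ^ 2 / (m * H ^ 2) = m * a ^ 2 / (8 * H ^ 2) := by
    field_simp; ring
  rw [hexp] at hmc
  have hsub : {x | ∀ v, m * a / 2 ≤ ∑ i, φ i (x i) v}ᶜ ⊆
      {x | ∫ y, f y ∂(Measure.pi ν) + m * a / 4 ≤ f x} := by
    intro x hx
    simp only [Set.mem_compl_iff, Set.mem_ofPred_eq, not_forall, not_le] at hx ⊢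
    obtain ⟨v, hv⟩ := hx
    have h1 := le_iSup_of_finite (fun v => ∑ i, (∫ y, φ i y v ∂(ν i) - φ i (x i) v)) v
    have h2 : m * a ≤ ∑ i, ∫ y, φ i y v ∂(ν i) := by
      refine le_trans (by simp) (Finset.sum_le_sum fun i _ => hmean i v)
    rw [Finset.sum_sub_distrib] at h1
    change _ ≤ f x at h1
    linarith
  have hmeas : MeasurableSet {x : Fin m → E | ∀ v, m * a / 2 ≤ ∑ i, φ i (x i) v} := by
    rw [Set.ofPred_forall]
    refine MeasurableSet.iInter fun v => measurableSet_le measurable_const ?_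
    exact Finset.measurable_sum _ fun i _ => (hφm i v).comp (measurable_pi_apply i)
  have hcompl := probReal_compl_eq_one_sub (μ := Measure.pi ν) hmeas
  have := (measureReal_mono (μ := Measure.pi ν) hsub).trans hmc
  linarith

/-- A uniform lower bound over an arbitrary set of parameters, from bounds on the expected
deviations over finite families of parameters. -/
lemma measureReal_forall_mem_le_sum {V : Type*} [TopologicalSpace V]
    [SecondCountableTopology V] (T : Set V) (ν : Fin m → Measure E)
    [∀ i, IsProbabilityMeasure (ν i)] {φ : Fin m → E → V → ℝ}
    (hφm : ∀ i v, Measurable fun x => φ i x v) (hφc : ∀ i x, Continuous (φ i x))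
    (hφ0 : ∀ i x v, 0 ≤ φ i x v)
    (hφH : ∀ i x v, φ i x v ≤ H) (hm : 0 < m) (hH : 0 < H) (ha : 0 ≤ a)
    (hmean : ∀ i, ∀ v ∈ T, a ≤ ∫ x, φ i x v ∂(ν i))
    (hsup : ∀ (N : ℕ) (u : Fin (N + 1) → V), (∀ k, u k ∈ T) →
      ∫ x, ⨆ k, ∑ i, (∫ y, φ i y (u k) ∂(ν i) - φ i (x i) (u k)) ∂(Measure.pi ν) ≤ m * a / 4) :
    1 - Real.exp (-(m * a ^ 2 / (8 * H ^ 2))) ≤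
      (Measure.pi ν).real {x | ∀ v ∈ T, m * a / 2 ≤ ∑ i, φ i (x i) v} := by
  rcases T.eq_empty_or_nonempty with rfl | hT
  · simp [Real.exp_nonneg]
  have : Nonempty T := hT.to_subtype
  -- The events for initial segments of a dense sequence decrease, and by continuity in `v` their
  -- intersection lies in the full event. The bound is uniform in `N`, so continuity from above
  -- transfers it.
  set u : ℕ → T := TopologicalSpace.denseSeq T
  set S : ℕ → Set (Fin m → E) :=
    fun N => {x | ∀ k : Fin (N + 1), m * a / 2 ≤ ∑ i, φ i (x i) (u k)}
  have hS : ∀ N, MeasurableSet (S N) := fun N => by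
    simp only [S, Set.ofPred_forall]
    refine MeasurableSet.iInter fun v => measurableSet_le measurable_const ?_
    exact Finset.measurable_sum _ fun i _ => (hφm i _).comp (measurable_pi_apply i)
  have hanti : Antitone S := fun N N' hN x hx k =>
    hx ⟨k, lt_of_lt_of_le k.2 (by omega)⟩
  have hinter : ⋂ N, S N ⊆ {x | ∀ v ∈ T, m * a / 2 ≤ ∑ i, φ i (x i) v} := by
    intro x hx v hv
    have hclosed : IsClosed {w : T | m * a / 2 ≤ ∑ i, φ i (x i) w} := by
      refine isClosed_le continuous_const (continuous_finsetSum _ fun i _ => ?_)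
      exact (hφc i (x i)).comp continuous_subtype_val
    have hrange : Set.range u ⊆ {w : T | m * a / 2 ≤ ∑ i, φ i (x i) w} := by
      rintro _ ⟨k, rfl⟩
      exact Set.mem_iInter.1 hx k ⟨k, Nat.lt_succ_self k⟩
    have huniv := (TopologicalSpace.denseRange_denseSeq T).closure_eq ▸
      hclosed.closure_subset_iff.2 hrange
    exact huniv (Set.mem_univ (⟨v, hv⟩ : T))
  refine le_trans ?_ (measureReal_mono (μ := Measure.pi ν) hinter)
  have htend : Filter.Tendsto (fun N => (Measure.pi ν).real (S N)) Filter.atTop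
      (nhds ((Measure.pi ν).real (⋂ N, S N))) :=
    (ENNReal.tendsto_toReal (measure_ne_top _ _)).comp
      (tendsto_measure_iInter_atTop (fun N => (hS N).nullMeasurableSet) hanti
        ⟨0, measure_ne_top _ _⟩)
  refine ge_of_tendsto' htend fun N => ?_
  exact measureReal_forall_le_sum_of_finite ν (φ := fun i x (k : Fin (N + 1)) => φ i x (u k))
    (fun i k => hφm i _) (fun i x k => hφ0 i x _) (fun i x k => hφH i x _) hm hH ha
    (fun i k => hmean i _ (u k).2) (hsup N (fun k => u k) fun k => (u k).2)

end UniformLowerBound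

/-! ### Moments of Rademacher averages -/

section Rademacher

variable {E : Type*} [MeasurableSpace E] {m : ℕ} (ν : Fin m → Measure E)
  [∀ i, IsProbabilityMeasure (ν i)]

lemma integral_sgn_mul_pow (μ : Measure E) [IsProbabilityMeasure μ] (c : E → ℝ) (l : ℕ) :
    ∫ z : E × Bool, (sgn z.2 * c z.1) ^ l ∂(μ.prod coin) =
      (∫ x, c x ^ l ∂μ) * ((1 + (-1) ^ l) / 2) := by
  have h : ∀ z : E × Bool, (sgn z.2 * c z.1) ^ l = c z.1 ^ l * sgn z.2 ^ l := fun z => by ring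
  simp_rw [h]
  rw [integral_prod_mul (fun x => c x ^ l) (fun b => sgn b ^ l), integral_coin]
  simp [sgn]

lemma measurable_sgn_mul {c : E → ℝ} (hc : Measurable c) :
    Measurable fun z : E × Bool => sgn z.2 * c z.1 :=
  ((measurable_of_finite sgn).comp measurable_snd).mul (hc.comp measurable_fst)

lemma memLp_sgn_mul {μ : Measure E} [IsProbabilityMeasure μ] {c : E → ℝ} (hcm : Measurable c)
    {p : ENNReal} (hc : MemLp c p μ) :
    MemLp (fun z : E × Bool => sgn z.2 * c z.1) p (μ.prod coin) := by
  have h : MemLp (fun z : E × Bool => c z.1) p (μ.prod coin) :=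
    hc.comp_measurePreserving measurePreserving_fst
  refine h.congr_norm (measurable_sgn_mul hcm).aestronglyMeasurable
    (Filter.Eventually.of_forall fun z => ?_)
  rw [norm_mul]
  cases z.2 <;> simp [sgn]

/-- Moment bound for a Rademacher average of independent random variables. -/
lemma integral_rademacher_pow_le (hm : 0 < m) {c : Fin m → E → ℝ} (hcm : ∀ i, Measurable (c i))
    {k : ℕ} (hc : ∀ i, MemLp (c i) (2 * k : ℕ) (ν i)) {d : ℝ} (hd : 0 ≤ d)
    (heven : ∀ i j, 1 ≤ j → j ≤ k →
      (∫ x, c i x ^ (2 * j) ∂(ν i)) / (2 * j).factorial ≤ d ^ j * (k / m * (1 / 2) ^ j)) :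
    Integrable (fun ω : Fin m → E × Bool => (∑ i, sgn (ω i).2 * c i (ω i).1) ^ (2 * k))
      (Measure.pi fun i => (ν i).prod coin) ∧
    ∫ ω, (∑ i, sgn (ω i).2 * c i (ω i).1) ^ (2 * k) ∂(Measure.pi fun i => (ν i).prod coin) ≤
      (4 * Real.exp 1 * d * k ^ 2) ^ k := by
  set z : Fin m → (Fin m → E × Bool) → ℝ := fun i ω => sgn (ω i).2 * c i (ω i).1
  have hmp := fun i => measurePreserving_eval (fun i => (ν i).prod coin) i
  have hz : iIndepFun z (Measure.pi fun i => (ν i).prod coin) :=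
    iIndepFun_pi (X := fun i (p : E × Bool) => sgn p.2 * c i p.1)
      fun i => (measurable_sgn_mul (hcm i)).aemeasurable
  have hzm : ∀ i, Measurable (z i) := fun i =>
    (measurable_sgn_mul (hcm i)).comp (measurable_pi_apply i)
  have hLp : ∀ i, MemLp (z i) (2 * k : ℕ) (Measure.pi fun i => (ν i).prod coin) := fun i =>
    (memLp_sgn_mul (hcm i) (hc i)).comp_measurePreserving (hmp i)
  have hpow : ∀ i l, ∫ ω, z i ω ^ l ∂(Measure.pi fun i => (ν i).prod coin) =
      (∫ x, c i x ^ l ∂(ν i)) * ((1 + (-1) ^ l) / 2) := fun i l => by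
    rw [← integral_sgn_mul_pow, ← (hmp i).map_eq,
      integral_map (hmp i).measurable.aemeasurable]
    · exact ((measurable_sgn_mul (hcm i)).pow_const l).aestronglyMeasurable
  refine ⟨integrable_pow_of_memLp (memLp_finsetSum Finset.univ fun i _ => hLp i) le_rfl,
    integral_sum_pow_even_le_of_geometric hz hm hzm hLp (fun i l hl _ => ?_) hd
      fun i j hj hjk => ?_⟩
  · rw [hpow, hl.neg_one_pow]; simp
  · rw [hpow, (even_two_mul j).neg_one_pow]
    simpa using heven i j hj hjk

/-- For bounded coefficients the factorial can be discarded; the right side is `b ^ (2 * j)` times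
`(m / k) ^ (j - 1) ≥ 1`. -/
lemma pow_div_factorial_le_geometric {m k j : ℕ} (hkm : k ≤ m) (hj : 1 ≤ j) (hjk : j ≤ k) (b : ℝ) :
    b ^ (2 * j) / (2 * j).factorial ≤
      (2 * b ^ 2 * m / k) ^ j * ((k : ℝ) / m * (1 / 2) ^ j) := by
  have hk : (0 : ℝ) < k := by exact_mod_cast (by omega : 0 < k)
  have hm : (0 : ℝ) < m := by exact_mod_cast (by omega : 0 < m)
  have hfac : (1 : ℝ) ≤ (2 * j).factorial := by exact_mod_cast Nat.factorial_pos _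
  have hb : 0 ≤ b ^ (2 * j) := by rw [pow_mul]; positivity
  have hratio : (1 : ℝ) ≤ m / k := by
    rw [one_le_div hk]; exact_mod_cast hkm
  obtain ⟨l, rfl⟩ := Nat.exists_eq_add_of_le' hj
  calc b ^ (2 * (l + 1)) / (2 * (l + 1)).factorial ≤ b ^ (2 * (l + 1)) := div_le_self hb hfac
    _ ≤ b ^ (2 * (l + 1)) * (m / k : ℝ) ^ l := le_mul_of_one_le_right hb (one_le_pow₀ hratio)
    _ = _ := by
      have : (2 * b ^ 2 * m / k : ℝ) = 2 * (b ^ 2 * (m / k)) := by ring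
      rw [this, mul_pow, mul_pow, pow_mul, pow_succ ((m : ℝ) / k)]
      have h2 : (2 : ℝ) ^ (l + 1) * (1 / 2) ^ (l + 1) = 1 := by rw [← mul_pow]; norm_num
      have h3 : (m / k : ℝ) * (k / m) = 1 := by field_simp
      calc _ = (b ^ 2) ^ (l + 1) * (m / k : ℝ) ^ l *
            ((2 : ℝ) ^ (l + 1) * (1 / 2) ^ (l + 1)) * ((m / k : ℝ) * (k / m)) := by
            rw [h2, h3]; ring
        _ = _ := by ring

/-- The growth condition on moments turned into a geometric bound. -/
lemma rpow_div_factorial_le_geometric {m k j : ℕ} {κ α : ℝ} (hkm : k ≤ m)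
    (hkm' : (2 * k : ℝ) ^ (2 * α - 1) ≤ m) (hj : 1 ≤ j) (hjk : j ≤ k) :
    (κ * (2 * j : ℝ) ^ α) ^ (2 * j) / (2 * j).factorial ≤
      (2 * Real.exp 2 * (2 : ℝ) ^ (2 * α - 1) * κ ^ 2 * m / k) ^ j *
        ((k : ℝ) / m * (1 / 2) ^ j) := by
  have hk : (0 : ℝ) < k := by exact_mod_cast (by omega : 0 < k)
  have hm : (0 : ℝ) < m := by exact_mod_cast (by omega : 0 < m)
  have hj0 : (0 : ℝ) < j := by exact_mod_cast hj
  have hj1 : (1 : ℝ) ≤ j := by exact_mod_cast hj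
  have hjk' : (j : ℝ) ≤ k := by exact_mod_cast hjk
  obtain ⟨γ, hγ⟩ : ∃ γ : ℝ, γ = 2 * α - 1 := ⟨_, rfl⟩
  rw [← hγ] at hkm' ⊢
  have hfac : (2 * j : ℝ) ^ (2 * j) ≤ Real.exp 2 ^ j * (2 * j).factorial := by
    have := Real.pow_div_factorial_le_exp (x := (2 * j : ℝ)) (by positivity) (2 * j)
    rw [div_le_iff₀ (by positivity)] at this
    rwa [← Real.exp_nat_mul, mul_comm (j : ℝ) 2]
  -- The factor `(2 * j) ^ (2 * j)` of the moment is absorbed by the factorial; this handles the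
  -- rest. For `γ ≤ 1` both factors are at most one. For `γ ≥ 1` the assumption `(2k)^γ ≤ m` cancels
  -- all but one factor `j ^ (γ - 1)`, and `j ≤ 2 ^ (j - 1)` disposes of that one.
  have hcore : ((j : ℝ) ^ (γ - 1) / 2) ^ j * (k / m : ℝ) ^ (j - 1) ≤ 1 := by
    have hw0 : 0 < (j : ℝ) ^ (γ - 1) := Real.rpow_pos_of_pos hj0 _
    obtain ⟨l, hl⟩ := Nat.exists_eq_add_of_le' hj
    rcases le_total γ 1 with hγ1 | hγ1
    · have h1 : (j : ℝ) ^ (γ - 1) / 2 ≤ 1 := by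
        have := Real.rpow_le_one_of_one_le_of_nonpos hj1 (by linarith : γ - 1 ≤ 0)
        linarith
      have h2 : (k / m : ℝ) ≤ 1 := by rw [div_le_one hm]; exact_mod_cast hkm
      exact mul_le_one₀ (pow_le_one₀ (by positivity) h1) (by positivity)
        (pow_le_one₀ (by positivity) h2)
    · have h1 : (k / m : ℝ) ≤ ((2 : ℝ) ^ γ * (j : ℝ) ^ (γ - 1))⁻¹ := by
        rw [div_le_iff₀ hm, ← div_eq_inv_mul, le_div_iff₀ (by positivity)]
        calc (k : ℝ) * ((2 : ℝ) ^ γ * (j : ℝ) ^ (γ - 1))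
            ≤ k * ((2 : ℝ) ^ γ * (k : ℝ) ^ (γ - 1)) := by
              gcongr
          _ = (2 * k : ℝ) ^ γ := by
              rw [Real.mul_rpow (by norm_num) hk.le]
              have : (k : ℝ) ^ γ = k * (k : ℝ) ^ (γ - 1) := by
                rw [Real.rpow_sub_one hk.ne']; field_simp
              rw [this]; ring
          _ ≤ m := hkm'
      have h2 : (j : ℝ) ^ (γ - 1) ≤ ((2 : ℝ) ^ γ) ^ l := by
        have hjl : (j : ℝ) ≤ (2 : ℝ) ^ l := by
          rw [hl]; exact_mod_cast Nat.lt_two_pow_self (n := l)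
        calc (j : ℝ) ^ (γ - 1) ≤ ((2 : ℝ) ^ l) ^ (γ - 1) :=
              Real.rpow_le_rpow hj0.le hjl (by linarith)
          _ ≤ ((2 : ℝ) ^ l) ^ γ :=
              Real.rpow_le_rpow_of_exponent_le (one_le_pow₀ (by norm_num)) (by linarith)
          _ = _ := by
              rw [← Real.rpow_natCast, ← Real.rpow_natCast, ← Real.rpow_mul (by norm_num),
                ← Real.rpow_mul (by norm_num), mul_comm]
      have hl' : j - 1 = l := by omega
      rw [hl']
      set w : ℝ := (j : ℝ) ^ (γ - 1)
      set t : ℝ := (2 : ℝ) ^ γ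
      have ht : 0 < t := by positivity
      calc (w / 2) ^ j * (k / m : ℝ) ^ l ≤ (w / 2) ^ j * ((t * w)⁻¹) ^ l := by gcongr
        _ = w / t ^ l * (1 / 2) ^ j := by
            rw [div_eq_mul_one_div w 2, mul_pow, hl, pow_succ w, inv_pow, mul_pow t w]; field_simp
        _ ≤ 1 * 1 := by
            gcongr
            · rw [div_le_one (by positivity)]; exact h2
            · exact pow_le_one₀ (by norm_num) (by norm_num)
        _ = 1 := one_mul 1
  have hexpand : (κ * (2 * j : ℝ) ^ α) ^ (2 * j) =
      κ ^ (2 * j) * (2 * j : ℝ) ^ (2 * j) * (((2 : ℝ) ^ γ) ^ j * ((j : ℝ) ^ (γ - 1) / 2) ^ j) := by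
    have h1 : ((2 * j : ℝ) ^ α) ^ 2 = (2 * j : ℝ) ^ 2 * ((2 : ℝ) ^ γ * ((j : ℝ) ^ (γ - 1) / 2)) := by
      have e1 : ((2 * j : ℝ) ^ α) ^ 2 = (2 * j : ℝ) ^ (γ + 1) := by
        rw [← Real.rpow_natCast, ← Real.rpow_mul (by positivity)]
        congr 1; rw [hγ]; push_cast; ring
      rw [e1, Real.mul_rpow (by norm_num) hj0.le, Real.rpow_add_one (by norm_num),
        Real.rpow_add_one hj0.ne', Real.rpow_sub_one hj0.ne']
      field_simp
    rw [mul_pow, pow_mul ((2 * j : ℝ) ^ α), h1, pow_mul (2 * j : ℝ)]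
    simp only [mul_pow]; ring
  rw [div_le_iff₀ (by positivity), hexpand]
  have hκ : 0 ≤ κ ^ (2 * j) := by rw [pow_mul]; positivity
  have hkm1 : (m / k : ℝ) ^ j * (k / m) * (k / m : ℝ) ^ (j - 1) = 1 := by
    obtain ⟨l, rfl⟩ := Nat.exists_eq_add_of_le' hj
    rw [Nat.add_sub_cancel, mul_assoc, ← pow_succ', ← mul_pow]
    have : (m / k : ℝ) * (k / m) = 1 := by field_simp
    rw [this, one_pow]
  have hq : 0 < (m / k : ℝ) ^ j * (k / m) := by positivity
  have hcore' : ((j : ℝ) ^ (γ - 1) / 2) ^ j ≤ (m / k : ℝ) ^ j * (k / m) := by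
    have h := mul_le_mul_of_nonneg_left hcore hq.le
    calc ((j : ℝ) ^ (γ - 1) / 2) ^ j
        = ((m / k : ℝ) ^ j * (k / m) * (k / m : ℝ) ^ (j - 1)) * ((j : ℝ) ^ (γ - 1) / 2) ^ j := by
          rw [hkm1, one_mul]
      _ = (m / k : ℝ) ^ j * (k / m) * (((j : ℝ) ^ (γ - 1) / 2) ^ j * (k / m : ℝ) ^ (j - 1)) := by
          ring
      _ ≤ _ := by linarith
  calc _ ≤ κ ^ (2 * j) * (Real.exp 2 ^ j * (2 * j).factorial) *
        (((2 : ℝ) ^ γ) ^ j * ((m / k : ℝ) ^ j * (k / m))) := by gcongr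
    _ = _ := by
      have h2 : (2 : ℝ) ^ j * (1 / 2) ^ j = 1 := by rw [← mul_pow]; norm_num
      have h3 : (2 * Real.exp 2 * (2 : ℝ) ^ γ * κ ^ 2 * m / k : ℝ) =
        2 * (Real.exp 2 * (2 : ℝ) ^ γ * κ ^ 2 * (m / k)) := by ring
      rw [h3, mul_pow, mul_pow, mul_pow, mul_pow, pow_mul]
      calc _ = (κ ^ 2) ^ j * (Real.exp 2 ^ j * (2 * j).factorial) *
          (((2 : ℝ) ^ γ) ^ j * ((m / k : ℝ) ^ j * (k / m))) * ((2 : ℝ) ^ j * (1 / 2) ^ j) := by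
            rw [h2, mul_one]
        _ = _ := by ring

end Rademacher

/-! ### Expected norms of Rademacher averages of rows -/

section RowAverages

variable {m n s : ℕ} (ν : Fin m → Measure (Fin n → ℝ)) [∀ i, IsProbabilityMeasure (ν i)]

lemma measurable_rademacher_sum {c : Fin m → (Fin n → ℝ) → ℝ} (hc : ∀ i, Measurable (c i)) :
    Measurable fun ω : Fin m → (Fin n → ℝ) × Bool => ∑ i, sgn (ω i).2 * c i (ω i).1 :=
  Finset.measurable_sum _ fun i _ => (measurable_sgn_mul (hc i)).comp (measurable_pi_apply i)

lemma abs_le_supNorm (B : Matrix (Fin m) (Fin n) ℝ) (i : Fin m) (j : Fin n) :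
    |B i j| ≤ supNorm B :=
  le_iSup_of_finite (fun ij : Fin m × Fin n => |B ij.1 ij.2|) (i, j)

lemma supNorm_nonneg (B : Matrix (Fin m) (Fin n) ℝ) : 0 ≤ supNorm B :=
  Real.iSup_nonneg fun _ => abs_nonneg _

lemma locFrob_nonneg (B : Matrix (Fin m) (Fin n) ℝ) : 0 ≤ locFrob B s :=
  Real.iSup_nonneg fun _ => Real.sqrt_nonneg _

/-- Cauchy–Schwarz against the `m` signs gives the Frobenius bound pointwise; the moment method with
`k = ⌈log n⌉` gives the other. The condition `n ≥ 2` keeps `log n` away from zero, so that rounding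
up costs only a constant. -/
lemma integral_topNorm_signal_le (hm : 0 < m) (hn : 2 ≤ n) (hs1 : 1 ≤ s) (hs : s ≤ n)
    (hmn : Real.log (Real.exp 1 * n) ≤ m) (B : Matrix (Fin m) (Fin n) ℝ) :
    Integrable (fun ω : Fin m → (Fin n → ℝ) × Bool =>
      topNorm s fun j => ∑ i, sgn (ω i).2 * B i j) (Measure.pi fun i => (ν i).prod coin) ∧
    ∫ ω, topNorm s (fun j => ∑ i, sgn (ω i).2 * B i j) ∂(Measure.pi fun i => (ν i).prod coin) ≤
      14 * √m * min (locFrob B s) (√(s * Real.log n) * supNorm B) := by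
  have hm' : (0 : ℝ) < m := by exact_mod_cast hm
  have hn' : (2 : ℝ) ≤ n := by exact_mod_cast hn
  have hs' : (1 : ℝ) ≤ s := by exact_mod_cast hs1
  set b := supNorm B
  have hb : 0 ≤ b := supNorm_nonneg B
  have hlog2 : (1 / 2 : ℝ) ≤ Real.log n := by
    have := Real.log_two_gt_d9
    have := Real.log_le_log (by norm_num) hn'
    linarith
  set k : ℕ := ⌈Real.log n⌉₊
  have hkge : Real.log n ≤ k := Nat.le_ceil _
  have hklt : (k : ℝ) < Real.log n + 1 := Nat.ceil_lt_add_one (by linarith)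
  have hk1 : 1 ≤ k := Nat.one_le_ceil_iff.2 (by linarith)
  have hk1' : (1 : ℝ) ≤ k := by exact_mod_cast hk1
  have hkm : k ≤ m := by
    rw [Real.log_mul (Real.exp_pos _).ne' (by positivity), Real.log_exp] at hmn
    have : (k : ℝ) < m + 1 := by linarith
    have : (k : ℝ) < (m + 1 : ℕ) := by push_cast; linarith
    have := Nat.cast_lt.1 this
    omega
  have hmom := fun j => integral_rademacher_pow_le ν hm (c := fun i _ => B i j)
    (fun i => measurable_const) (k := k) (fun i => memLp_const _)
    (d := 2 * b ^ 2 * m / k) (by positivity) (fun i l hl hlk => by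
      refine le_trans ?_ (pow_div_factorial_le_geometric hkm hl hlk b)
      simp only [integral_const, probReal_univ, one_smul]
      refine div_le_div_of_nonneg_right ?_ (by positivity)
      rw [pow_mul, pow_mul]
      refine pow_le_pow_left₀ (sq_nonneg _) ?_ l
      exact sq_le_sq' (by linarith [neg_abs_le (B i j), abs_le_supNorm B i j])
        ((le_abs_self _).trans (abs_le_supNorm B i j)))
  have hA : 0 ≤ b * √(8 * Real.exp 1 * m * k) := by positivity
  have htop := integral_topNorm_le hs1 hs hk1
    (fun j => measurable_rademacher_sum (fun i => measurable_const (a := B i j)))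
    (fun j => (hmom j).1) hA (Real.exp_pos (1 / 2)).le (fun j => (hmom j).2.trans_eq (by
      rw [pow_mul, mul_pow b, Real.sq_sqrt (by positivity)]
      congr 1; field_simp; ring)) (by
      rw [← Real.exp_nat_mul]
      calc (n : ℝ) = Real.exp (Real.log n) := (Real.exp_log (by linarith)).symm
        _ ≤ Real.exp (((2 * k : ℕ) : ℝ) * (1 / 2)) := by
            rw [Real.exp_le_exp]; push_cast; linarith
        _ ≤ _ := le_mul_of_one_le_left (Real.exp_pos _).le hs')
  refine ⟨htop.1, ?_⟩
  rw [mul_min_of_nonneg _ _ (by positivity)]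
  refine le_min ?_ ?_
  · calc _ ≤ ∫ _ω : Fin m → (Fin n → ℝ) × Bool, √m * locFrob B s
          ∂(Measure.pi fun i => (ν i).prod coin) := by
          refine integral_mono htop.1 (integrable_const _) fun ω =>
            topNorm_le_mul_locFrob hs B fun j => ?_
          have h := Finset.sum_mul_sq_le_sq_mul_sq Finset.univ (fun i => sgn (ω i).2)
            (fun i => B i j)
          simpa [sgn_sq] using h
      _ = √m * locFrob B s := by simp
      _ ≤ _ := by
          have : 0 ≤ √m * locFrob B s := mul_nonneg (Real.sqrt_nonneg _) (locFrob_nonneg B)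
          nlinarith
  · refine htop.2.trans ?_
    have h1 : √s * Real.exp (1 / 2) * (b * √(8 * Real.exp 1 * m * k)) =
        √(s * Real.exp 1 * (8 * Real.exp 1 * m * k)) * b := by
      rw [Real.exp_half 1,
        Real.sqrt_mul (by positivity) (8 * Real.exp 1 * m * k),
        Real.sqrt_mul (by positivity) (Real.exp 1)]
      ring
    have h2 : 14 * √m * (√(s * Real.log n) * b) = √(14 ^ 2 * m * (s * Real.log n)) * b := by
      rw [Real.sqrt_mul (by positivity) (s * Real.log n), Real.sqrt_mul (by positivity) (m : ℝ),
        Real.sqrt_sq (by norm_num)]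
      ring
    rw [h1, h2]
    refine mul_le_mul_of_nonneg_right (Real.sqrt_le_sqrt ?_) hb
    have he : Real.exp 1 ^ 2 ≤ 8 := by
      have := Real.exp_one_lt_d9
      nlinarith [Real.exp_pos 1]
    have hk3 : (k : ℝ) ≤ 3 * Real.log n := by linarith
    calc (s : ℝ) * Real.exp 1 * (8 * Real.exp 1 * m * k)
        = (8 * m * s) * (Real.exp 1 ^ 2 * k) := by ring
      _ ≤ (8 * m * s) * (8 * (3 * Real.log n)) := by gcongr
      _ ≤ 14 ^ 2 * m * (s * Real.log n) := by
          have : 0 ≤ (m : ℝ) * s * Real.log n := by positivity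
          nlinarith

/-- The moment method with `2 * k` of order `log (e n / s)`. From `n = 3` on, `log (e n) ≥ 2`, so at
least the second moment is covered by the growth condition. -/
lemma integral_topNorm_noise_le (hm : 0 < m) (hn : 3 ≤ n) (hs1 : 1 ≤ s) (hs : s ≤ n) {κ α : ℝ}
    (hκ : 0 < κ) (hα : 1 / 2 ≤ α)
    (hmn : Real.log (Real.exp 1 * n) ^ max (2 * α - 1) 1 ≤ m)
    (hLp : ∀ i j (l : ℕ), 1 ≤ l → 2 * (l : ℝ) ≤ Real.log (Real.exp 1 * n) →
      MemLp (fun x : Fin n → ℝ => x j) (2 * l : ℕ) (ν i) ∧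
      ∫ x, x j ^ (2 * l) ∂(ν i) ≤ (κ * (2 * l : ℝ) ^ α) ^ (2 * l)) :
    Integrable (fun ω : Fin m → (Fin n → ℝ) × Bool =>
      topNorm s fun j => ∑ i, sgn (ω i).2 * (ω i).1 j) (Measure.pi fun i => (ν i).prod coin) ∧
    ∫ ω, topNorm s (fun j => ∑ i, sgn (ω i).2 * (ω i).1 j)
        ∂(Measure.pi fun i => (ν i).prod coin) ≤
      100 * √m * (Real.exp (2 * α) * κ * √(s * Real.log (Real.exp 1 * n / s))) := by
  have hm' : (0 : ℝ) < m := by exact_mod_cast hm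
  have hn' : (3 : ℝ) ≤ n := by exact_mod_cast hn
  have hs' : (1 : ℝ) ≤ s := by exact_mod_cast hs1
  have hsn : (s : ℝ) ≤ n := by exact_mod_cast hs
  set P : ℝ := Real.log (Real.exp 1 * n)
  set L : ℝ := Real.log (Real.exp 1 * n / s)
  have hP2 : 2 ≤ P := by
    have h1 : Real.exp 1 ≤ n := by linarith [Real.exp_one_lt_d9]
    have : Real.log (Real.exp 1 * Real.exp 1) ≤ P :=
      Real.log_le_log (by positivity) (by gcongr)
    rw [← Real.exp_add, Real.log_exp] at this
    linarith
  have hLP : L ≤ P := Real.log_le_log (by positivity)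
    (div_le_self (by positivity) hs')
  have hL1 : 1 ≤ L := by
    rw [Real.le_log_iff_exp_le (by positivity), le_div_iff₀ (by positivity)]
    gcongr
  -- Rounding down keeps `2 * k` within the admissible moment range; still `L ≤ 4 * k`, so `D = exp
  -- 2` suffices.
  set k : ℕ := max 1 ⌊L / 2⌋₊
  have hk1 : 1 ≤ k := le_max_left _ _
  have hfl : (⌊L / 2⌋₊ : ℝ) ≤ L / 2 := Nat.floor_le (by linarith)
  have hfl' : L / 2 < ⌊L / 2⌋₊ + 1 := Nat.lt_floor_add_one _
  have hkcast : (k : ℝ) = max 1 (⌊L / 2⌋₊ : ℝ) := by simp [k]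
  have hkL : (k : ℝ) ≤ L := by rw [hkcast]; exact max_le hL1 (by linarith)
  have h2kP : 2 * (k : ℝ) ≤ P := by
    rw [hkcast, mul_max_of_nonneg _ _ (by norm_num)]
    exact max_le (by linarith) (by linarith)
  have hL4k : L ≤ 4 * k := by
    have h1 : (1 : ℝ) ≤ k := by exact_mod_cast hk1
    have h2 : (⌊L / 2⌋₊ : ℝ) ≤ k := by rw [hkcast]; exact le_max_right _ _
    linarith
  have hk1' : (1 : ℝ) ≤ k := by exact_mod_cast hk1
  have hPm : P ≤ m := by
    refine le_trans ?_ hmn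
    calc P = P ^ (1 : ℝ) := (Real.rpow_one _).symm
      _ ≤ _ := Real.rpow_le_rpow_of_exponent_le (by linarith) (le_max_right _ _)
  have hkm : k ≤ m := by exact_mod_cast (by linarith : (k : ℝ) ≤ m)
  have hkm' : (2 * k : ℝ) ^ (2 * α - 1) ≤ m := by
    refine le_trans ?_ hmn
    calc (2 * k : ℝ) ^ (2 * α - 1) ≤ P ^ (2 * α - 1) :=
          Real.rpow_le_rpow (by positivity) h2kP (by linarith)
      _ ≤ _ := Real.rpow_le_rpow_of_exponent_le (by linarith) (le_max_left _ _)
  set d : ℝ := 2 * Real.exp 2 * (2 : ℝ) ^ (2 * α - 1) * κ ^ 2 * m / k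
  have hmom := fun j => integral_rademacher_pow_le ν hm (c := fun _ x => x j)
    (fun i => measurable_pi_apply j) (k := k) (fun i => (hLp i j k hk1 h2kP).1)
    (d := d) (by positivity) (fun i l hl hlk => by
      refine le_trans ?_ (rpow_div_factorial_le_geometric hkm hkm' hl hlk)
      gcongr
      refine (hLp i j l hl (le_trans ?_ h2kP)).2
      have : (l : ℝ) ≤ k := by exact_mod_cast hlk
      linarith)
  set A : ℝ := κ * (2 : ℝ) ^ α * √(4 * Real.exp 3 * m * k)
  have hA : 0 ≤ A := by positivity
  have hA2 : A ^ 2 = 4 * Real.exp 1 * d * k ^ 2 := by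
    simp only [A, d]
    rw [mul_pow, mul_pow, Real.sq_sqrt (by positivity),
      show Real.exp 3 = Real.exp 1 * Real.exp 2 by rw [← Real.exp_add]; norm_num,
      show ((2 : ℝ) ^ α) ^ 2 = 2 * (2 : ℝ) ^ (2 * α - 1) by
        rw [Real.rpow_sub_one (by norm_num), ← Real.rpow_natCast, ← Real.rpow_mul (by norm_num)]
        push_cast
        rw [mul_comm α]; ring]
    field_simp
  have htop := integral_topNorm_le hs1 hs hk1
    (fun j => measurable_rademacher_sum (fun i => measurable_pi_apply j))
    (fun j => (hmom j).1) hA (Real.exp_pos 2).le (fun j => (hmom j).2.trans_eq (by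
      rw [pow_mul, hA2])) (by
      rw [← Real.exp_nat_mul]
      calc (n : ℝ) ≤ s * (Real.exp 1 * n / s) := by
            rw [mul_div_cancel₀ _ (by positivity)]
            exact le_mul_of_one_le_left (by positivity) (Real.one_le_exp (by norm_num))
        _ = s * Real.exp L := by rw [Real.exp_log (by positivity)]
        _ ≤ _ := by
            gcongr; push_cast; linarith)
  refine ⟨htop.1, htop.2.trans ?_⟩
  have h2α : (2 : ℝ) ^ α ≤ Real.exp (2 * α) := by
    rw [Real.rpow_def_of_pos (by norm_num), Real.exp_le_exp]
    have := Real.log_two_lt_d9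
    nlinarith
  have hnum : √s * Real.exp 2 * √(4 * Real.exp 3 * m * k) ≤ 100 * √m * √(s * L) := by
    have h1 : √s * Real.exp 2 * √(4 * Real.exp 3 * m * k) =
        √(s * Real.exp 2 ^ 2 * (4 * Real.exp 3 * m * k)) := by
      rw [Real.sqrt_mul (by positivity) (4 * Real.exp 3 * m * k),
        Real.sqrt_mul (by positivity) (Real.exp 2 ^ 2),
        Real.sqrt_sq (Real.exp_pos 2).le]
    have h2 : 100 * √m * √(s * L) = √(100 ^ 2 * m * (s * L)) := by
      rw [Real.sqrt_mul (by positivity) (s * L), Real.sqrt_mul (by positivity) (m : ℝ),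
        Real.sqrt_sq (by norm_num)]
    rw [h1, h2]
    refine Real.sqrt_le_sqrt ?_
    have he : Real.exp 2 ^ 2 * Real.exp 3 ≤ 2500 := by
      rw [← Real.exp_nat_mul, ← Real.exp_add,
        show ((2 : ℕ) : ℝ) * 2 + 3 = ((7 : ℕ) : ℝ) * 1 by norm_num, Real.exp_nat_mul]
      calc Real.exp 1 ^ 7 ≤ (2.7182818286 : ℝ) ^ 7 := by
            gcongr; exact Real.exp_one_lt_d9.le
        _ ≤ 2500 := by norm_num
    calc (s : ℝ) * Real.exp 2 ^ 2 * (4 * Real.exp 3 * m * k)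
        = (4 * m * s) * (Real.exp 2 ^ 2 * Real.exp 3 * k) := by ring
      _ ≤ (4 * m * s) * (2500 * L) := by gcongr
      _ = _ := by ring
  calc √s * Real.exp 2 * A
      = κ * (2 : ℝ) ^ α * (√s * Real.exp 2 * √(4 * Real.exp 3 * m * k)) := by
        simp only [A]; ring
    _ ≤ κ * Real.exp (2 * α) * (100 * √m * √(s * L)) := by gcongr
    _ = _ := by ring

/-- For `n ≤ 2` one has `log (e n) < 2`, so the growth condition says nothing about second moments.
Here `k = 1` and `D = √2` suffice. -/
lemma integral_topNorm_noise_le_of_variance (hm : 0 < m) (hn : n ≤ 2) (hs1 : 1 ≤ s) (hs : s ≤ n)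
    {σ₂ : ℝ} (hσ : 0 ≤ σ₂) (hLp : ∀ i j, MemLp (fun x : Fin n → ℝ => x j) (2 : ℕ) (ν i))
    (h2 : ∀ i j, ∫ x, x j ^ 2 ∂(ν i) = σ₂) :
    Integrable (fun ω : Fin m → (Fin n → ℝ) × Bool =>
      topNorm s fun j => ∑ i, sgn (ω i).2 * (ω i).1 j) (Measure.pi fun i => (ν i).prod coin) ∧
    ∫ ω, topNorm s (fun j => ∑ i, sgn (ω i).2 * (ω i).1 j)
        ∂(Measure.pi fun i => (ν i).prod coin) ≤ 5 * √m * (√s * √σ₂) := by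
  have hm' : (0 : ℝ) < m := by exact_mod_cast hm
  have hs' : (1 : ℝ) ≤ s := by exact_mod_cast hs1
  have hn' : (n : ℝ) ≤ 2 := by exact_mod_cast hn
  have hmom := fun j => integral_rademacher_pow_le ν hm (c := fun _ x => x j)
    (fun i => measurable_pi_apply j) (k := 1) (fun i => hLp i j)
    (d := m * σ₂) (by positivity) (fun i l hl hlk => by
      obtain rfl : l = 1 := by omega
      simp only [mul_one, h2, pow_one, Nat.cast_one, Nat.factorial_two, Nat.cast_ofNat]
      refine le_of_eq ?_
      field_simp)
  have htop := integral_topNorm_le hs1 hs le_rfl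
    (fun j => measurable_rademacher_sum (fun i => measurable_pi_apply j))
    (fun j => (hmom j).1) (Real.sqrt_nonneg (4 * Real.exp 1 * (m * σ₂)))
    (Real.sqrt_nonneg 2) (fun j => (hmom j).2.trans_eq (by
      rw [mul_one, Real.sq_sqrt (by positivity)]; simp)) (by
      rw [mul_one, Real.sq_sqrt (by norm_num)]
      linarith)
  refine ⟨htop.1, htop.2.trans ?_⟩
  have h1 : √s * √2 * √(4 * Real.exp 1 * (m * σ₂)) = √(8 * Real.exp 1) * √m * (√s * √σ₂) := by
    rw [Real.sqrt_mul (by positivity) (m * σ₂), Real.sqrt_mul hm'.le,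
      show (8 * Real.exp 1) = 2 * (4 * Real.exp 1) by ring, Real.sqrt_mul (by norm_num) (4 * _)]
    ring
  rw [h1]
  have h5 : √(8 * Real.exp 1) ≤ 5 := by
    rw [Real.sqrt_le_left (by norm_num)]
    linarith [Real.exp_one_lt_d9]
  gcongr

end RowAverages

/-! ### From lower bounds on the cone to the robust null space property -/

section Cone

variable {m n s : ℕ}

/-- Unit vectors whose `ℓ₁` norm is at most `(1 + ρ⁻¹) √s`. -/
def unitCone (n s : ℕ) (ρ : ℝ) : Set (Fin n → ℝ) :=
  {v | ∑ j, v j ^ 2 = 1 ∧ ∑ j, |v j| ≤ (1 + ρ⁻¹) * √s}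

/-- If the inequality failed for `v` and `S`, then `‖v_{Sᶜ}‖₁` would be below `ρ⁻¹ √s ‖v_S‖₂`,
placing `v / ‖v‖₂` in the cone, and `τ ‖A v‖₂` would be below `‖v‖₂`, contradicting the lower bound
there. -/
lemma l2RNSP_of_unitCone {A : Matrix (Fin m) (Fin n) ℝ} {ρ τ : ℝ} (hρ : 0 < ρ) (hτ : 0 < τ)
    (hs1 : 1 ≤ s) (hA : ∀ v ∈ unitCone n s ρ, (1 / τ) ^ 2 ≤ ∑ i, A.mulVec v i ^ 2) :
    L2RNSP A s ρ τ := by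
  intro S hS v
  by_contra! hlt
  have hs' : (0 : ℝ) < √s := Real.sqrt_pos.2 (by exact_mod_cast hs1)
  set a := √(∑ j ∈ S, v j ^ 2)
  set r := √(∑ j, v j ^ 2)
  have har : a ≤ r := Real.sqrt_le_sqrt (Finset.sum_le_univ_sum_of_nonneg fun j => sq_nonneg _)
  have hout0 : 0 ≤ ∑ j ∈ Sᶜ, |v j| := Finset.sum_nonneg fun j _ => abs_nonneg _
  have hAv : 0 ≤ τ * √(∑ i, A.mulVec v i ^ 2) := by positivity
  have hρs : 0 ≤ ρ / √s * ∑ j ∈ Sᶜ, |v j| := by positivity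
  have hr : 0 < r := by linarith
  have hr2 : r ^ 2 = ∑ j, v j ^ 2 := Real.sq_sqrt (Finset.sum_nonneg fun j _ => sq_nonneg _)
  have hin : ∑ j ∈ S, |v j| ≤ √s * a := by
    have h := Real.sum_mul_le_sqrt_mul_sqrt S (fun _ => (1 : ℝ)) (fun j => |v j|)
    simp only [one_mul, one_pow, sq_abs, Finset.sum_const, nsmul_eq_mul, mul_one] at h
    refine h.trans (mul_le_mul_of_nonneg_right (Real.sqrt_le_sqrt ?_) (Real.sqrt_nonneg _))
    exact_mod_cast hS
  have hout : ∑ j ∈ Sᶜ, |v j| ≤ ρ⁻¹ * √s * a := by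
    have h : ρ / √s * ∑ j ∈ Sᶜ, |v j| ≤ a := by linarith
    rw [div_mul_eq_mul_div, div_le_iff₀ hs'] at h
    calc ∑ j ∈ Sᶜ, |v j| = ρ⁻¹ * (ρ * ∑ j ∈ Sᶜ, |v j|) := by field_simp
      _ ≤ ρ⁻¹ * (a * √s) := by gcongr
      _ = _ := by ring
  have hmem : (fun j => r⁻¹ * v j) ∈ unitCone n s ρ := by
    constructor
    · simp_rw [mul_pow]
      rw [← Finset.mul_sum, ← hr2]
      field_simp
    · simp_rw [abs_mul, abs_of_pos (inv_pos.2 hr)]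
      rw [← Finset.mul_sum, inv_mul_le_iff₀ hr, ← Finset.sum_add_sum_compl S]
      calc _ ≤ (1 + ρ⁻¹) * √s * a := by linarith
        _ ≤ (1 + ρ⁻¹) * √s * r := mul_le_mul_of_nonneg_left har (by positivity)
        _ = _ := by ring
  have hlow := hA _ hmem
  have hmv : ∀ i, A.mulVec (fun j => r⁻¹ * v j) i = r⁻¹ * A.mulVec v i := fun i => by
    have := congrFun (A.mulVec_smul r⁻¹ v) i
    simpa [Pi.smul_def] using this
  simp_rw [hmv, mul_pow] at hlow
  rw [← Finset.mul_sum] at hlow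
  have h1 : (r / τ) ^ 2 ≤ ∑ i, A.mulVec v i ^ 2 := by
    calc (r / τ) ^ 2 = r ^ 2 * (1 / τ) ^ 2 := by ring
      _ ≤ r ^ 2 * (r⁻¹ ^ 2 * ∑ i, A.mulVec v i ^ 2) := by gcongr
      _ = _ := by field_simp
  have h2 : r / τ ≤ √(∑ i, A.mulVec v i ^ 2) := Real.le_sqrt_of_sq_le h1
  rw [div_le_iff₀ hτ] at h2
  linarith

end Cone

/-! ### Expected deviations of truncated quadratic forms -/

section Deviation

variable {m n s : ℕ} (ν : Fin m → Measure (Fin n → ℝ)) [∀ i, IsProbabilityMeasure (ν i)]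

/-- The square of `⟨b + x, v⟩` truncated at level `H`. -/
def truncSq (H : ℝ) (b x v : Fin n → ℝ) : ℝ := min ((∑ j, v j * (b j + x j)) ^ 2) H

lemma measurable_truncSq (H : ℝ) (b v : Fin n → ℝ) : Measurable fun x => truncSq H b x v := by
  unfold truncSq
  fun_prop

lemma continuous_truncSq (H : ℝ) (b x : Fin n → ℝ) : Continuous (truncSq H b x) := by
  unfold truncSq
  fun_prop

lemma truncSq_nonneg {H : ℝ} (hH : 0 ≤ H) (b x v : Fin n → ℝ) : 0 ≤ truncSq H b x v :=
  le_min (sq_nonneg _) hH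

lemma integrable_truncSq {H : ℝ} (hH : 0 ≤ H) (b v : Fin n → ℝ) (μ : Measure (Fin n → ℝ))
    [IsProbabilityMeasure μ] : Integrable (fun x => truncSq H b x v) μ :=
  integrable_of_abs_le (measurable_truncSq H b v) H fun x => by
    rw [abs_of_nonneg (truncSq_nonneg hH b x v)]; exact min_le_right _ _

/-- The Lipschitz constant `2 * √H` is doubled by symmetrization. Interchanging the two sums exposes
one linear functional of `v`, to which `sum_mul_le_topNorm` applies. -/
lemma integral_iSup_deviation_le {ι : Type*} [Finite ι] [Nonempty ι] {H : ℝ} (hH : 0 ≤ H)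
    (hs1 : 1 ≤ s) (hs : s ≤ n) {ρ : ℝ} (hρ : 0 < ρ)
    (B : Matrix (Fin m) (Fin n) ℝ) (hinteg : ∀ i j, Integrable (fun x : Fin n → ℝ => x j) (ν i))
    (u : ι → Fin n → ℝ) (hu : ∀ k, u k ∈ unitCone n s ρ)
    (hg : Integrable (fun ω : Fin m → (Fin n → ℝ) × Bool =>
      topNorm s fun j => ∑ i, sgn (ω i).2 * B i j) (Measure.pi fun i => (ν i).prod coin))
    (hy : Integrable (fun ω : Fin m → (Fin n → ℝ) × Bool =>
      topNorm s fun j => ∑ i, sgn (ω i).2 * (ω i).1 j) (Measure.pi fun i => (ν i).prod coin)) :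
    ∫ x, ⨆ k, ∑ i, (∫ y, truncSq H (B i) y (u k) ∂(ν i) - truncSq H (B i) (x i) (u k))
        ∂(Measure.pi ν) ≤
      4 * √H * (2 + ρ⁻¹) *
        (∫ ω, topNorm s (fun j => ∑ i, sgn (ω i).2 * B i j)
            ∂(Measure.pi fun i => (ν i).prod coin) +
          ∫ ω, topNorm s (fun j => ∑ i, sgn (ω i).2 * (ω i).1 j)
            ∂(Measure.pi fun i => (ν i).prod coin)) := by
  have hq : ∀ i k, Integrable (fun x : Fin n → ℝ => 4 * √H * ∑ j, u k j * (B i j + x j)) (ν i) :=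
    fun i k => (integrable_finsetSum _ fun j _ =>
      ((integrable_const _).add (hinteg i j)).const_mul _).const_mul _
  have hcomp := integral_iSup_sum_le_of_contraction ν
    (ψ := fun i x k => truncSq H (B i) x (u k))
    (q := fun i x k => 4 * √H * ∑ j, u k j * (B i j + x j)) (fun _ => 0)
    (fun i k => integrable_truncSq hH _ _ _) hq (fun i x k l => by
      rw [← mul_sub, abs_mul, abs_of_nonneg (by positivity : 0 ≤ 4 * √H)]
      have := abs_min_sq_sub_min_sq_le hH (∑ j, u k j * (B i j + x j))
        (∑ j, u l j * (B i j + x j))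
      simp only [truncSq]
      linarith)
  simp only [zero_add] at hcomp
  refine hcomp.trans ?_
  rw [← integral_add hg hy, ← integral_const_mul]
  have hqs : ∀ i k, Integrable (fun ω : Fin m → (Fin n → ℝ) × Bool =>
      sgn (ω i).2 * (4 * √H * ∑ j, u k j * (B i j + (ω i).1 j)))
      (Measure.pi fun i => (ν i).prod coin) := fun i k =>
    (measurePreserving_eval (fun i => (ν i).prod coin) i).integrable_comp_of_integrable
      (g := fun z : (Fin n → ℝ) × Bool => sgn z.2 * (4 * √H * ∑ j, u k j * (B i j + z.1 j)))
      (by simpa only [mul_comm] using (hq i k).mul_prod (integrable_coin sgn))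
  refine integral_mono (integrable_iSup fun k => integrable_finsetSum _ fun i _ => hqs i k)
    ((hg.add hy).const_mul _) fun ω => ciSup_le fun k => ?_
  have hswap : ∑ i, sgn (ω i).2 * (4 * √H * ∑ j, u k j * (B i j + (ω i).1 j)) =
      4 * √H * ∑ j, u k j * (∑ i, sgn (ω i).2 * B i j + ∑ i, sgn (ω i).2 * (ω i).1 j) := by
    simp_rw [← Finset.sum_add_distrib, Finset.mul_sum]
    rw [Finset.sum_comm]
    refine Finset.sum_congr rfl fun j _ => Finset.sum_congr rfl fun i _ => ?_
    ring
  rw [hswap, mul_assoc (4 * √H)]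
  refine mul_le_mul_of_nonneg_left ?_ (by positivity)
  refine (sum_mul_le_topNorm hs1 hs (hu k).1.le (hu k).2 _).trans ?_
  exact mul_le_mul_of_nonneg_left (topNorm_add_le hs _ _) (by positivity)

end Deviation

/-! ### Random matrices with independent entries -/

section RandomMatrix

variable {Ω : Type*} [MeasurableSpace Ω] {P : Measure Ω}

lemma integral_pow_le_of_eLpNorm_le {X : Ω → ℝ} (hX : AEStronglyMeasurable X P) {l : ℕ}
    (hl : 1 ≤ l) {a : ℝ} (ha : 0 ≤ a)
    (h : eLpNorm X (ENNReal.ofReal (2 * l)) P ≤ ENNReal.ofReal a) :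
    MemLp X (2 * l : ℕ) P ∧ ∫ ω, X ω ^ (2 * l) ∂P ≤ a ^ (2 * l) := by
  have hcast : ENNReal.ofReal (2 * l) = ((2 * l : ℕ) : ENNReal) := by
    rw [← ENNReal.ofReal_natCast]; push_cast; rfl
  rw [hcast] at h
  have hmem : MemLp X (2 * l : ℕ) P := ⟨hX, h.trans_lt ENNReal.ofReal_lt_top⟩
  refine ⟨hmem, ?_⟩
  have hne : ((2 * l : ℕ) : ENNReal) ≠ 0 := by
    simp only [ne_eq, Nat.cast_eq_zero]; omega
  rw [hmem.eLpNorm_eq_integral_rpow_norm hne (ENNReal.natCast_ne_top _)] at h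
  rw [ENNReal.ofReal_le_ofReal_iff ha, ENNReal.toReal_natCast] at h
  have hI : 0 ≤ ∫ ω, ‖X ω‖ ^ (((2 * l : ℕ) : ℝ)) ∂P :=
    integral_nonneg fun ω => Real.rpow_nonneg (norm_nonneg _) _
  have h' := pow_le_pow_left₀ (Real.rpow_nonneg hI _) h (2 * l)
  rw [← Real.rpow_natCast, ← Real.rpow_mul hI, inv_mul_cancel₀ (by positivity),
    Real.rpow_one] at h'
  refine le_trans (le_of_eq (integral_congr_ae (Filter.Eventually.of_forall fun ω => ?_))) h'
  simp only [Real.rpow_natCast, Real.norm_eq_abs]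
  rw [pow_mul, pow_mul, sq_abs]

lemma integral_abs_le_of_eLpNorm_le {X : Ω → ℝ} (hX : AEStronglyMeasurable X P) {a : ℝ}
    (ha : 0 ≤ a) (h : eLpNorm X 1 P ≤ ENNReal.ofReal a) : ∫ ω, |X ω| ∂P ≤ a := by
  have hn := integral_norm_eq_lintegral_enorm hX
  simp only [Real.norm_eq_abs] at hn
  rw [hn, ← eLpNorm_one_eq_lintegral_enorm]
  exact ENNReal.toReal_le_of_le_ofReal ha h

variable [IsProbabilityMeasure P]

lemma sq_integral_sq_le {X : Ω → ℝ} (hX : MemLp X (4 : ℕ) P) :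
    (∫ ω, X ω ^ 2 ∂P) ^ 2 ≤ ∫ ω, X ω ^ 4 ∂P := by
  have h := (convexOn_pow (𝕜 := ℝ) 2).map_integral_le (μ := P) (f := fun ω => X ω ^ 2)
    (continuousOn_pow _) isClosed_Ici (Filter.Eventually.of_forall fun ω => sq_nonneg (X ω))
    (integrable_pow_of_memLp hX (by norm_num))
    (by simpa [Function.comp_def, ← pow_mul] using
      integrable_pow_of_memLp hX (l := 4) (by norm_num))
  simpa [Function.comp_def, ← pow_mul] using h

/-- Both sides are the product of the entry laws up to currying the index pair. This lets the rows
be treated as coordinates of a product space. -/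
lemma map_rows_eq_pi {m n : ℕ} {X : Fin m → Fin n → Ω → ℝ} (hX : ∀ i j, Measurable (X i j))
    (hind : iIndepFun (fun (ij : Fin m × Fin n) => X ij.1 ij.2) P) :
    P.map (fun ω i j => X i j ω) = Measure.pi fun i => P.map fun ω j => X i j ω := by
  have hprob : ∀ i j, IsProbabilityMeasure (P.map (X i j)) := fun i j =>
    Measure.isProbabilityMeasure_map (hX i j).aemeasurable
  have hrow : ∀ i, P.map (fun ω j => X i j ω) = Measure.infinitePi fun j => P.map (X i j) :=
    fun i => (hind.precomp (g := fun j => (i, j)) fun j j' h => by simpa using h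
      ).map_fun_eq_infinitePi_map (fun j => hX i j)
  have hall := hind.map_fun_eq_infinitePi_map fun ij : Fin m × Fin n => hX ij.1 ij.2
  have hrowp : ∀ i, IsProbabilityMeasure (P.map fun ω j => X i j ω) := fun i =>
    Measure.isProbabilityMeasure_map (measurable_pi_iff.2 fun j => hX i j).aemeasurable
  rw [← Measure.infinitePi_eq_pi]
  simp_rw [hrow]
  rw [← Measure.infinitePi_map_curry (fun i j => P.map (X i j)), ← hall,
    Measure.map_map (MeasurableEquiv.measurable _)
      (measurable_pi_iff.2 fun ij : Fin m × Fin n => hX ij.1 ij.2)]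
  rfl

end RandomMatrix

/-! ### Combining the bounds for centred noise plus a fixed matrix -/

section Main

variable {Ω : Type*} [MeasurableSpace Ω] {P : Measure Ω} [IsProbabilityMeasure P] {m n s : ℕ}

/-- The expected norm of the Rademacher averages, noise and signal together. -/
lemma integral_topNorm_add_le {ν : Fin m → Measure (Fin n → ℝ)} [∀ i, IsProbabilityMeasure (ν i)]
    (hm : 0 < m) (hn : 2 ≤ n) (hs1 : 1 ≤ s) (hs : s ≤ n) (B : Matrix (Fin m) (Fin n) ℝ)
    {κ α σ₂ μ₄ : ℝ} (hκ : 0 < κ) (hα : 1 / 2 ≤ α) (hσ0 : 0 < σ₂) (hσ : σ₂ ^ 2 ≤ μ₄)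
    (hmn : Real.log (Real.exp 1 * n) ^ max (2 * α - 1) 1 ≤ m)
    (h4 : ∀ i j, MemLp (fun x : Fin n → ℝ => x j) (4 : ℕ) (ν i))
    (hm1 : ∀ i j, ∫ x, |x j| ∂(ν i) ≤ κ)
    (hm2 : ∀ i j, ∫ x, x j ^ 2 ∂(ν i) = σ₂) (hm4 : ∀ i j, ∫ x, x j ^ 4 ∂(ν i) ≤ μ₄)
    (hLp : ∀ i j (l : ℕ), 1 ≤ l → 2 * (l : ℝ) ≤ Real.log (Real.exp 1 * n) →
      MemLp (fun x : Fin n → ℝ => x j) (2 * l : ℕ) (ν i) ∧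
      ∫ x, x j ^ (2 * l) ∂(ν i) ≤ (κ * (2 * l : ℝ) ^ α) ^ (2 * l)) :
    Integrable (fun ω : Fin m → (Fin n → ℝ) × Bool =>
      topNorm s fun j => ∑ i, sgn (ω i).2 * B i j) (Measure.pi fun i => (ν i).prod coin) ∧
    Integrable (fun ω : Fin m → (Fin n → ℝ) × Bool =>
      topNorm s fun j => ∑ i, sgn (ω i).2 * (ω i).1 j) (Measure.pi fun i => (ν i).prod coin) ∧
    ∫ ω, topNorm s (fun j => ∑ i, sgn (ω i).2 * B i j) ∂(Measure.pi fun i => (ν i).prod coin) +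
      ∫ ω, topNorm s (fun j => ∑ i, sgn (ω i).2 * (ω i).1 j)
        ∂(Measure.pi fun i => (ν i).prod coin) ≤
      100 * √m * (√μ₄ / σ₂) * (Real.exp (2 * α) * κ * √(s * Real.log (Real.exp 1 * n / s)) +
        min (locFrob B s) (√(s * Real.log n) * supNorm B)) := by
  have hs' : (1 : ℝ) ≤ s := by exact_mod_cast hs1
  have hn' : (2 : ℝ) ≤ n := by exact_mod_cast hn
  have hsn : (s : ℝ) ≤ n := by exact_mod_cast hs
  have hP1 : 1 ≤ Real.log (Real.exp 1 * n) := by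
    rw [Real.le_log_iff_exp_le (by positivity)]
    exact le_mul_of_one_le_right (Real.exp_pos _).le (by linarith)
  have hL1 : 1 ≤ Real.log (Real.exp 1 * n / s) := by
    rw [Real.le_log_iff_exp_le (by positivity), le_div_iff₀ (by positivity)]
    gcongr
  have hmlog : Real.log (Real.exp 1 * n) ≤ m := by
    refine le_trans ?_ hmn
    calc _ = Real.log (Real.exp 1 * n) ^ (1 : ℝ) := (Real.rpow_one _).symm
      _ ≤ _ := Real.rpow_le_rpow_of_exponent_le hP1 (le_max_right _ _)
  have hμ0 : 0 < μ₄ := lt_of_lt_of_le (by positivity) hσ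
  have hQ : 1 ≤ √μ₄ / σ₂ := by
    rw [one_le_div hσ0]; exact Real.le_sqrt_of_sq_le hσ
  have hF : 0 ≤ min (locFrob B s) (√(s * Real.log n) * supNorm B) :=
    le_min (locFrob_nonneg B) (mul_nonneg (Real.sqrt_nonneg _) (supNorm_nonneg B))
  set F := min (locFrob B s) (√(s * Real.log n) * supNorm B)
  obtain ⟨hg, hgle⟩ := integral_topNorm_signal_le ν hm hn hs1 hs hmlog B
  have hnoise : Integrable (fun ω : Fin m → (Fin n → ℝ) × Bool =>
      topNorm s fun j => ∑ i, sgn (ω i).2 * (ω i).1 j) (Measure.pi fun i => (ν i).prod coin) ∧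
      ∫ ω, topNorm s (fun j => ∑ i, sgn (ω i).2 * (ω i).1 j)
        ∂(Measure.pi fun i => (ν i).prod coin) ≤
      100 * √m * (√μ₄ / σ₂) *
        (Real.exp (2 * α) * κ * √(s * Real.log (Real.exp 1 * n / s))) := by
    rcases Nat.lt_or_ge 2 n with hn3 | hn2
    · obtain ⟨hy, hyle⟩ := integral_topNorm_noise_le ν hm hn3 hs1 hs hκ hα hmn hLp
      refine ⟨hy, hyle.trans (mul_le_mul_of_nonneg_right ?_ (by positivity))⟩
      exact le_mul_of_one_le_right (by positivity) hQ
    · obtain ⟨hy, hyle⟩ := integral_topNorm_noise_le_of_variance ν hm hn2 hs1 hs hσ0.le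
        (fun i j => (h4 i j).mono_exponent (by norm_num)) hm2
      refine ⟨hy, hyle.trans ?_⟩
      -- Interpolating the second moment between the first and the fourth brings `κ` back in; this
      -- is the origin of the factor `√μ₄ / σ₂`.
      have hvar := variance_le_of_first_fourth (h4 ⟨0, hm⟩ ⟨0, by omega⟩) (hm1 _ _) (hm2 _ _)
        (hm4 _ _) hσ0 hμ0
      have hexp : 1 ≤ Real.exp (2 * α) := Real.one_le_exp (by linarith)
      have hss : √s ≤ √(s * Real.log (Real.exp 1 * n / s)) :=
        Real.sqrt_le_sqrt (le_mul_of_one_le_right (by positivity) hL1)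
      calc 5 * √m * (√s * √σ₂)
          ≤ 5 * √m * (√(s * Real.log (Real.exp 1 * n / s)) * (3 * κ * (√μ₄ / σ₂))) := by gcongr
        _ = 15 * 1 * (√m * (√μ₄ / σ₂) * (κ * √(s * Real.log (Real.exp 1 * n / s)))) := by ring
        _ ≤ 100 * Real.exp (2 * α) *
            (√m * (√μ₄ / σ₂) * (κ * √(s * Real.log (Real.exp 1 * n / s)))) := by
            gcongr; norm_num
        _ = _ := by ring
  refine ⟨hg, hnoise.1, ?_⟩
  have hg' : 14 * √m * F ≤ 100 * √m * (√μ₄ / σ₂) * F := by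
    have : 0 ≤ √m * F := by positivity
    have h := mul_le_mul_of_nonneg_left hQ this
    calc 14 * √m * F = 14 * (√m * F * 1) := by ring
      _ ≤ 100 * (√m * F * (√μ₄ / σ₂)) := by
          nlinarith [mul_nonneg this (zero_le_one.trans hQ)]
      _ = _ := by ring
  rw [mul_add]
  linarith [hnoise.2]

/-- The robust null space property for a deterministic matrix plus centred noise with
independent entries. -/
lemma le_measureReal_l2RNSP {X : Fin m → Fin n → Ω → ℝ} (hX : ∀ i j, Measurable (X i j))
    (hind : iIndepFun (fun (ij : Fin m × Fin n) => X ij.1 ij.2) P)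
    (h4 : ∀ i j, MemLp (X i j) (4 : ℕ) P) (h0 : ∀ i j, ∫ ω, X i j ω ∂P = 0)
    {κ α ρ τ σ₂ μ₄ : ℝ} (hm2 : ∀ i j, ∫ ω, X i j ω ^ 2 ∂P = σ₂)
    (hm4 : ∀ i j, ∫ ω, X i j ω ^ 4 ∂P ≤ μ₄) (hσ0 : 0 < σ₂) (hσ : σ₂ ^ 2 ≤ μ₄)
    (hκ : 0 < κ) (hα : 1 / 2 ≤ α)
    (hreas : ∀ i j, Reasonable κ α (Real.log (Real.exp 1 * n)) (X i j) P)
    (hρ : 0 < ρ) (hρ1 : ρ < 1) (hτ : 0 < τ) (hm : 0 < m) (hs1 : 1 ≤ s) (hs : s ≤ n)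
    (B : Matrix (Fin m) (Fin n) ℝ)
    (hmn : Real.log (Real.exp 1 * n) ^ max (2 * α - 1) 1 ≤ m)
    (hmτ : 2 / (√σ₂ * τ) ≤ √m)
    (hmF : 38400 * (μ₄ / (σ₂ ^ 2 * √σ₂)) * ρ⁻¹ *
      (Real.exp (2 * α) * κ * √(s * Real.log (Real.exp 1 * n / s)) +
        min (locFrob B s) (√(s * Real.log n) * supNorm B)) ≤ √m) :
    1 - Real.exp (-(m * σ₂ ^ 4 / (8192 * μ₄ ^ 2))) ≤
      P.real {ω | L2RNSP (Matrix.of fun i j => B i j + X i j ω) s ρ τ} := by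
  have hm' : (0 : ℝ) < m := by exact_mod_cast hm
  have hn1 : (1 : ℝ) ≤ n := by exact_mod_cast hs1.trans hs
  have hμ0 : 0 < μ₄ := lt_of_lt_of_le (by positivity) hσ
  have hrowm : ∀ i, Measurable fun ω j => X i j ω := fun i => measurable_pi_iff.2 (hX i)
  have hallm : Measurable fun ω i j => X i j ω := measurable_pi_iff.2 hrowm
  set ν : Fin m → Measure (Fin n → ℝ) := fun i => P.map fun ω j => X i j ω
  have hν : ∀ i, IsProbabilityMeasure (ν i) := fun i =>
    Measure.isProbabilityMeasure_map (hrowm i).aemeasurable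
  have hlaw : P.map (fun ω i j => X i j ω) = Measure.pi ν := map_rows_eq_pi hX hind
  have hintegν : ∀ i {f : (Fin n → ℝ) → ℝ}, Measurable f →
      ∫ x, f x ∂(ν i) = ∫ ω, f (fun j => X i j ω) ∂P := fun i f hf =>
    integral_map (hrowm i).aemeasurable hf.aestronglyMeasurable
  have hLpν : ∀ i j {p : ENNReal}, MemLp (X i j) p P →
      MemLp (fun x : Fin n → ℝ => x j) p (ν i) := fun i j p h =>
    (memLp_map_measure_iff (measurable_pi_apply j).aestronglyMeasurable
      (hrowm i).aemeasurable).2 h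
  set H : ℝ := 16 * μ₄ / σ₂
  have hH : 0 < H := by positivity
  have hP1 : 1 ≤ Real.log (Real.exp 1 * n) := by
    rw [Real.le_log_iff_exp_le (by positivity)]
    exact le_mul_of_one_le_right (Real.exp_pos _).le hn1
  have hmean : ∀ i (v : Fin n → ℝ), ∑ j, v j ^ 2 = 1 →
      σ₂ / 2 ≤ ∫ x, truncSq H (B i) x v ∂(ν i) := fun i v hv => by
    obtain ⟨k1, k2, k3, k4⟩ := integral_linearForm_moments
      (hind.precomp (g := fun j => (i, j)) fun j j' h => by simpa using h)
      (fun j => hX i j) (fun j => h4 i j) (fun j => h0 i j) (fun j => hm2 i j)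
      (fun j => hm4 i j) hσ v Finset.univ
    rw [hv, mul_one] at k3
    rw [hv, one_pow, mul_one] at k4
    have := half_variance_le_integral_min_sq k1 k2 hσ0 k3 k4 hσ (∑ j, v j * B i j)
    rw [hintegν i (measurable_truncSq H (B i) v)]
    simpa only [truncSq, mul_add, Finset.sum_add_distrib] using this
  have hτm : (1 / τ) ^ 2 ≤ m * (σ₂ / 2) / 2 := by
    have h1 := pow_le_pow_left₀ (by positivity) hmτ 2
    rw [Real.sq_sqrt hm'.le, div_pow, mul_pow, Real.sq_sqrt hσ0.le,
      div_le_iff₀ (by positivity)] at h1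
    rw [div_pow, div_le_iff₀ (by positivity)]
    linarith
  -- The index set is left free: the cone is used for `n ≥ 2`, a single vector for `n = 1`.
  have key : ∀ T : Set (Fin n → ℝ), (∀ v ∈ T, ∑ j, v j ^ 2 = 1) →
      (∀ (N : ℕ) (u : Fin (N + 1) → Fin n → ℝ), (∀ k, u k ∈ T) →
        ∫ x, ⨆ k, ∑ i, (∫ y, truncSq H (B i) y (u k) ∂(ν i) - truncSq H (B i) (x i) (u k))
          ∂(Measure.pi ν) ≤ m * (σ₂ / 2) / 4) →
      (∀ A : Matrix (Fin m) (Fin n) ℝ, (∀ v ∈ T, (1 / τ) ^ 2 ≤ ∑ i, A.mulVec v i ^ 2) →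
        L2RNSP A s ρ τ) →
      1 - Real.exp (-(m * σ₂ ^ 4 / (8192 * μ₄ ^ 2))) ≤
        P.real {ω | L2RNSP (Matrix.of fun i j => B i j + X i j ω) s ρ τ} := by
    intro T hT hsup hA
    have h := measureReal_forall_mem_le_sum T ν (φ := fun i x v => truncSq H (B i) x v)
      (fun i v => measurable_truncSq H (B i) v) (fun i x => continuous_truncSq H (B i) x)
      (fun i x v => truncSq_nonneg hH.le _ _ _) (fun i x v => min_le_right _ _) hm hH
      (by positivity : 0 ≤ σ₂ / 2) (fun i v hv => hmean i v (hT v hv)) hsup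
    have hexp : (m : ℝ) * (σ₂ / 2) ^ 2 / (8 * H ^ 2) = m * σ₂ ^ 4 / (8192 * μ₄ ^ 2) := by
      simp only [H]; field_simp; norm_num
    rw [hexp] at h
    refine h.trans ?_
    -- Closedness supplies the measurability needed to pass from the law of the matrix to `P`.
    have hclosed : IsClosed {x : Fin m → Fin n → ℝ |
        ∀ v ∈ T, m * (σ₂ / 2) / 2 ≤ ∑ i, truncSq H (B i) (x i) v} := by
      simp only [Set.ofPred_forall]
      refine isClosed_biInter fun v _ => isClosed_le continuous_const ?_
      unfold truncSq
      fun_prop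
    rw [← hlaw, map_measureReal_apply hallm hclosed.measurableSet]
    refine measureReal_mono fun ω hω => hA _ fun v hv => (hτm.trans (hω v hv)).trans ?_
    refine Finset.sum_le_sum fun i _ => (min_le_left _ _).trans_eq ?_
    simp [Matrix.mulVec, dotProduct, mul_comm]
  rcases Nat.lt_or_ge 1 n with hn | hn
  · refine key (unitCone n s ρ) (fun v hv => hv.1) (fun N u hu => ?_)
      fun A hA => l2RNSP_of_unitCone hρ hτ hs1 hA
    have hreas1 : ∀ i j, ∫ x, |x j| ∂(ν i) ≤ κ := fun i j => by
      rw [hintegν i (measurable_pi_apply j).abs]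
      refine integral_abs_le_of_eLpNorm_le (hX i j).aestronglyMeasurable hκ.le ?_
      simpa using hreas i j 1 le_rfl hP1
    obtain ⟨hg, hy, hgy⟩ := integral_topNorm_add_le (ν := ν) hm hn hs1 hs B hκ hα hσ0 hσ hmn
      (fun i j => hLpν i j (h4 i j)) hreas1
      (fun i j => (hintegν i ((measurable_pi_apply j).pow_const 2)).trans (hm2 i j))
      (fun i j => (hintegν i ((measurable_pi_apply j).pow_const 4)).trans_le (hm4 i j))
      (fun i j l hl hlP => by
        have hl' : (1 : ℝ) ≤ l := by exact_mod_cast hl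
        have := integral_pow_le_of_eLpNorm_le (hX i j).aestronglyMeasurable hl
          (by positivity) (hreas i j (2 * l) (by linarith) hlP)
        exact ⟨hLpν i j this.1,
          (hintegν i ((measurable_pi_apply j).pow_const (2 * l))).trans_le this.2⟩)
    refine (integral_iSup_deviation_le ν hH.le hs1 hs hρ B
      (fun i j => (hLpν i j (h4 i j)).integrable (by norm_num)) u hu hg hy).trans ?_
    set Y : ℝ := Real.exp (2 * α) * κ * √(s * Real.log (Real.exp 1 * n / s)) +
        min (locFrob B s) (√(s * Real.log n) * supNorm B)
    have hY : 0 ≤ Y := add_nonneg (by positivity)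
      (le_min (locFrob_nonneg B) (mul_nonneg (Real.sqrt_nonneg _) (supNorm_nonneg B)))
    have hsqH : √H = 4 * (√μ₄ / √σ₂) := by
      simp only [H]
      rw [Real.sqrt_div (by positivity), Real.sqrt_mul (by norm_num),
        show (16 : ℝ) = 4 ^ 2 by norm_num, Real.sqrt_sq (by norm_num)]
      ring
    have hρ3 : 2 + ρ⁻¹ ≤ 3 * ρ⁻¹ := by
      have := (one_le_inv₀ hρ).2 hρ1.le
      linarith
    have hsσ : 0 < √σ₂ := Real.sqrt_pos.2 hσ0
    calc _ ≤ 4 * √H * (3 * ρ⁻¹) * (100 * √m * (√μ₄ / σ₂) * Y) := by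
          gcongr
          exact add_nonneg (integral_nonneg fun ω => topNorm_nonneg _)
            (integral_nonneg fun ω => topNorm_nonneg _)
      _ = √m * (σ₂ / 8) * (38400 * ((√μ₄) ^ 2 / (σ₂ ^ 2 * √σ₂)) * ρ⁻¹ * Y) := by
          rw [hsqH]; field_simp; ring
      _ ≤ √m * (σ₂ / 8) * √m := by
          rw [Real.sq_sqrt hμ0.le]
          gcongr
      _ = m * (σ₂ / 2) / 4 := by
          rw [mul_right_comm, Real.mul_self_sqrt hm'.le]; ring
  -- Here `log n = 0` makes the signal term in the hypothesis vanish. But unit vectors are `±1` and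
  -- squares ignore the sign, so one vector suffices, and its centred sum has mean zero.
  · obtain rfl : n = 1 := le_antisymm hn (hs1.trans hs)
    refine key {fun _ => 1} (by simp) (fun N u hu => ?_) fun A hA => ?_
    · have hu' : ∀ k, u k = fun _ => 1 := hu
      simp_rw [hu', ciSup_const]
      have hev : ∀ i, Integrable (fun x : Fin m → Fin 1 → ℝ => truncSq H (B i) (x i) fun _ => 1)
          (Measure.pi ν) := fun i =>
        (measurePreserving_eval ν i).integrable_comp_of_integrable
          (integrable_truncSq hH.le (B i) (fun _ => 1) (ν i))
      rw [integral_finsetSum]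
      swap
      · exact fun i _ => (integrable_const _).sub (hev i)
      refine le_trans (le_of_eq (Finset.sum_eq_zero fun i _ => ?_)) (by positivity)
      rw [integral_sub (integrable_const _) (hev i)]
      have := integral_map (μ := Measure.pi ν) (measurePreserving_eval ν i).measurable.aemeasurable
        (f := fun y => truncSq H (B i) y fun _ => 1)
        (measurable_truncSq H (B i) fun _ => 1).aestronglyMeasurable
      rw [(measurePreserving_eval ν i).map_eq] at this
      simp only [Function.eval] at this
      simp [this]
    · refine l2RNSP_of_unitCone hρ hτ hs1 fun v hv => ?_
      have hv1 : v 0 ^ 2 = 1 := by simpa using hv.1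
      refine (hA _ rfl).trans_eq (Finset.sum_congr rfl fun i _ => ?_)
      simp [Matrix.mulVec, dotProduct, mul_pow, hv1]

end Main

/-! ### Central moments of the matrix entries -/

section Assembly

variable {Ω : Type*} [MeasurableSpace Ω] {P : Measure Ω} {m n : ℕ}

lemma abs_centralMoment_le_muMat (k : ℕ) (R : Ω → Matrix (Fin m) (Fin n) ℝ) (i : Fin m)
    (j : Fin n) : |centralMoment (fun ω => R ω i j) k P| ≤ muMat k R P :=
  le_iSup_of_finite
    (fun ij : Fin m × Fin n => |centralMoment (fun ω => R ω ij.1 ij.2) k P|) (i, j)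

lemma muMat_nonneg (k : ℕ) (R : Ω → Matrix (Fin m) (Fin n) ℝ) : 0 ≤ muMat k R P :=
  Real.iSup_nonneg fun _ => abs_nonneg _

lemma muMat_four_le_KMat (R : Ω → Matrix (Fin m) (Fin n) ℝ) : muMat 4 R P ≤ KMat R P := by
  have h2 := muMat_nonneg 2 R (P := P)
  have h3 := muMat_nonneg 3 R (P := P)
  have := mul_nonneg h2 h3
  unfold KMat
  nlinarith

lemma centralMoment_eq_integral (X : Ω → ℝ) (k : ℕ) :
    centralMoment X k P = ∫ ω, (X ω - ∫ ω', X ω' ∂P) ^ k ∂P := by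
  simp [centralMoment]

lemma centralMoment_two_eq_muMat {R : Ω → Matrix (Fin m) (Fin n) ℝ} (hR : IsCentral 2 R P)
    (i : Fin m) (j : Fin n) : centralMoment (fun ω => R ω i j) 2 P = muMat 2 R P := by
  have h0 : 0 ≤ centralMoment (fun ω => R ω i j) 2 P := by
    rw [centralMoment_eq_integral]
    exact integral_nonneg fun ω => sq_nonneg _
  have : Nonempty (Fin m × Fin n) := ⟨(i, j)⟩
  unfold muMat
  have h : ∀ ij : Fin m × Fin n, |centralMoment (fun ω => R ω ij.1 ij.2) 2 P| =
      centralMoment (fun ω => R ω i j) 2 P := fun ij => by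
    rw [hR 2 (by norm_num) le_rfl ij.1 i ij.2 j, abs_of_nonneg h0]
  simp_rw [h, ciSup_const]

end Assembly

end RNSP

end

/-! ### The main theorem -/

open RNSP in
theorem mainTheorem2 :
    ∃ c : ℝ, 0 < c ∧ ∃ C : ℝ, 0 < C ∧
      ∀ (Ω : Type*) [MeasurableSpace Ω] (P : Measure Ω) [IsProbabilityMeasure P]
        (m n : ℕ) (M : Matrix (Fin m) (Fin n) ℝ) (R : Ω → Matrix (Fin m) (Fin n) ℝ)
        (κ α ρ τ : ℝ) (s : ℕ),
        (∀ i j, Measurable fun ω => R ω i j) →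
        iIndepFun (fun (ij : Fin m × Fin n) ω => R ω ij.1 ij.2) P →
        (∀ i j, MemLp (fun ω => R ω i j) 4 P) →
        RNSP.IsCentral 2 R P →
        0 < κ → 1 / 2 ≤ α →
        RNSP.ReasonableMat κ α (Real.log (Real.exp 1 * n))
          (fun ω => R ω - RNSP.expMatrix R P) P →
        0 < ρ → ρ < 1 → 0 < τ → 1 ≤ s → s ≤ n →
        max
          (C * (RNSP.KMat R P / (RNSP.muMat 2 R P ^ (5 / 2 : ℝ) * τ) *
            (1 + τ * ρ⁻¹ *
              (Real.exp (2 * α) * κ * √(s * Real.log (Real.exp 1 * n / s)) +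
                RNSP.FMat s (fun ω => M + R ω) P))) ^ 2)
          (Real.log (Real.exp 1 * n) ^ max (2 * α - 1) 1) ≤ (m : ℝ) →
        1 - Real.exp (-(c * (RNSP.muMat 2 R P ^ 4 / RNSP.KMat R P ^ 2 * m))) ≤
          P.real {ω | RNSP.L2RNSP (M + R ω) s ρ τ} := by
  -- Both constants come from `le_measureReal_l2RNSP`; the square appears because its conditions
  -- bound `√m`.
  refine ⟨1 / 8192, by norm_num, 38400 ^ 2, by norm_num, ?_⟩
  intro Ω _ P _ m n M R κ α ρ τ s hmeas hind hLp hcen hκ hα hreas hρ hρ1 hτ hs1 hs hmax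
  have hn1 : (1 : ℝ) ≤ n := by exact_mod_cast hs1.trans hs
  have hmn := (le_max_right _ _).trans hmax
  have hmC := (le_max_left _ _).trans hmax
  have hP1 : 1 ≤ Real.log (Real.exp 1 * n) := by
    rw [Real.le_log_iff_exp_le (by positivity)]
    exact le_mul_of_one_le_right (Real.exp_pos _).le hn1
  have hm1 : (1 : ℝ) ≤ m :=
    (Real.one_le_rpow hP1 (zero_le_one.trans (le_max_right _ _))).trans hmn
  have hm : 0 < m := by exact_mod_cast zero_lt_one.trans_le hm1
  -- With zero variance the asserted lower bound is `1 - exp 0 = 0`.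
  rcases (muMat_nonneg 2 R (P := P)).eq_or_lt with hμ | hσ0
  · simp [← hμ]
  set σ₂ := muMat 2 R P
  set μ₄ := muMat 4 R P
  set X : Fin m → Fin n → Ω → ℝ := fun i j ω => R ω i j - ∫ ω', R ω' i j ∂P
  have hinteg : ∀ i j, Integrable (fun ω => R ω i j) P := fun i j =>
    (hLp i j).integrable (by norm_num)
  have h4 : ∀ i j, MemLp (X i j) (4 : ℕ) P := fun i j =>
    MemLp.sub (by exact_mod_cast hLp i j) (memLp_const _)
  have hm2 : ∀ i j, ∫ ω, X i j ω ^ 2 ∂P = σ₂ := fun i j =>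
    (centralMoment_eq_integral _ 2).symm.trans (centralMoment_two_eq_muMat hcen i j)
  have hm4 : ∀ i j, ∫ ω, X i j ω ^ 4 ∂P ≤ μ₄ := fun i j =>
    (centralMoment_eq_integral _ 4).symm.trans_le
      ((le_abs_self _).trans (abs_centralMoment_le_muMat 4 R i j))
  have hσ : σ₂ ^ 2 ≤ μ₄ := by
    have h := sq_integral_sq_le (h4 ⟨0, hm⟩ ⟨0, by omega⟩)
    rw [hm2] at h
    exact h.trans (hm4 _ _)
  have hμ0 : 0 < μ₄ := lt_of_lt_of_le (by positivity) hσ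
  have hK : μ₄ ≤ KMat R P := muMat_four_le_KMat R
  set K := KMat R P
  have hK0 : 0 < K := hμ0.trans_le hK
  set B : Matrix (Fin m) (Fin n) ℝ := expMatrix (fun ω => M + R ω) P
  have hB : ∀ i j, B i j = M i j + ∫ ω, R ω i j ∂P := fun i j => by
    simp only [B, expMatrix, Matrix.of_apply, Matrix.add_apply]
    rw [integral_add (integrable_const _) (hinteg i j)]
    simp
  have hXind : iIndepFun (fun (ij : Fin m × Fin n) => X ij.1 ij.2) P :=
    hind.comp (fun ij x => x - ∫ ω, R ω ij.1 ij.2 ∂P) fun ij => measurable_sub_const _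
  set Y : ℝ := Real.exp (2 * α) * κ * √(s * Real.log (Real.exp 1 * n / s)) +
    FMat s (fun ω => M + R ω) P
  have hY : 0 ≤ Y := add_nonneg (by positivity)
    (le_min (locFrob_nonneg _) (mul_nonneg (Real.sqrt_nonneg _) (supNorm_nonneg _)))
  have hsσ : 0 < √σ₂ := Real.sqrt_pos.2 hσ0
  have hrpow : σ₂ ^ (5 / 2 : ℝ) = σ₂ ^ 2 * √σ₂ := by
    rw [show (5 / 2 : ℝ) = (2 : ℕ) + 1 / 2 by norm_num, Real.rpow_add hσ0, Real.rpow_natCast,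
      ← Real.sqrt_eq_rpow]
  rw [hrpow] at hmC
  have hsqrt : 38400 * (K / (σ₂ ^ 2 * √σ₂ * τ) * (1 + τ * ρ⁻¹ * Y)) ≤ √m := by
    refine Real.le_sqrt_of_sq_le ?_
    rw [mul_pow]; exact hmC
  -- The first summand makes the mean `m σ₂ / 4` exceed `1 / τ²`, using `σ₂² ≤ K`; the second
  -- controls the expected deficit, using `μ₄ ≤ K`.
  have hsplit : 38400 * (K / (σ₂ ^ 2 * √σ₂ * τ) * (1 + τ * ρ⁻¹ * Y)) =
      38400 * (K / (σ₂ ^ 2 * √σ₂ * τ)) + 38400 * (K / (σ₂ ^ 2 * √σ₂)) * ρ⁻¹ * Y := by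
    field_simp
  rw [hsplit] at hsqrt
  have hmτ : 2 / (√σ₂ * τ) ≤ √m := by
    have h1 : 2 / (√σ₂ * τ) ≤ 38400 * (K / (σ₂ ^ 2 * √σ₂ * τ)) := by
      calc 2 / (√σ₂ * τ) = 2 * (σ₂ ^ 2 / (σ₂ ^ 2 * √σ₂ * τ)) := by field_simp
        _ ≤ 38400 * (K / (σ₂ ^ 2 * √σ₂ * τ)) := by
            gcongr
            · norm_num
            · exact hσ.trans hK
    have h2 : 0 ≤ 38400 * (K / (σ₂ ^ 2 * √σ₂)) * ρ⁻¹ * Y := by positivity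
    linarith
  have hmF : 38400 * (μ₄ / (σ₂ ^ 2 * √σ₂)) * ρ⁻¹ * Y ≤ √m := by
    have h1 : 0 ≤ 38400 * (K / (σ₂ ^ 2 * √σ₂ * τ)) := by positivity
    have h2 : 38400 * (μ₄ / (σ₂ ^ 2 * √σ₂)) * ρ⁻¹ * Y ≤
        38400 * (K / (σ₂ ^ 2 * √σ₂)) * ρ⁻¹ * Y := by gcongr
    linarith
  have hfinal := le_measureReal_l2RNSP (P := P) (X := X)
    (fun i j => (hmeas i j).sub_const _) hXind h4
    (fun i j => by simp [X, integral_sub (hinteg i j) (integrable_const _)])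
    hm2 hm4 hσ0 hσ hκ hα (fun i j => hreas i j) hρ hρ1 hτ hm hs1 hs B hmn hmτ hmF
  have hset : ∀ ω, (Matrix.of fun i j => B i j + X i j ω) = M + R ω := fun ω => by
    ext i j
    simp [hB, X]
  simp_rw [hset] at hfinal
  refine le_trans ?_ hfinal
  refine sub_le_sub_left (Real.exp_le_exp.2 (neg_le_neg ?_)) 1
  calc 1 / 8192 * (σ₂ ^ 4 / K ^ 2 * m) ≤ 1 / 8192 * (σ₂ ^ 4 / μ₄ ^ 2 * m) := by gcongr
    _ = _ := by field_simp
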